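/- \textbf{Setting.} Let $L\ge 1$ be an integer and let $\Lambda=(\mathbb Z/L\mathbb Z)\times M$, with $M$ a finite set, be the set of sites of a lattice that is periodic of length $L$ in the direction of the first coordinate $x$; write $N=|\Lambda|$ and let $\tau(x,m)=(x+1,m)$. Let $\Lambda$ carry a $\tau$-invariant metric $\mathrm{dist}$ for which the lattice is finite-dimensional and $L$ is a length: with constants $D,\kappa,a$, every ball of radius $r\ge0$ contains at most $\kappa(1+r)^D$ sites, and $\min_{n\in\mathbb Z}|x(i)-x(j)+nL|\le a\,\mathrm{dist}(i,j)$ for all sites $i,j$. Suppose $N\le P(L)$ for a polynomial $P$. The data $D,\kappa,a,P$ are called the lattice geometry. Each site $(x,m)$ carries a Hilbert space $\mathbb C^{d(m)}$; operators act on the tensor product of all of these, on which $T$ is the unitary translation operator induced by $\tau$. Let $H=\sum_{Z\subseteq\Lambda}H_Z$, where $H_Z$ is Hermitian and supported on $Z$, $\|H_Z\|\le J$, and $H_Z=0$ if $\mathrm{diam}(Z)>R$, and suppose $[T,H]=0$. For each site $i$ let $q_i$ be a Hermitian operator supported on $i$, with integer eigenvalues and $\|q_i\|\le q_{\max}$,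 such that $Tq_iT^{-1}=q_{\tau(i)}$; let $Q=\sum_i q_i$ and suppose $[Q,H]=0$. Let $\psi_0$ be a normalized ground state of $H$. \textbf{Theorem 4 (higher-dimensional Lieb--Schultz--Mattis).} For all $R$, $J$, $q_{\max}$ and every lattice geometry there is a constant $C$, depending on nothing else (in particular not on $L$, $M$, the metric, the dimensions $d(m)$, $H$ or the $q_i$), such that in the above setting, if the filling factor $\rho=\langle\psi_0,Q\psi_0\rangle/L$ is not an integer, then either the ground state energy $E_0$ is a degenerate eigenvalue of $H$, or $H$ has a first excited energy $E_1>E_0$ and the gap satisfies $$\Delta E=E_1-E_0\le C\,\frac{\log L}{L}.$$ -/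

import Mathlib

open scoped BigOperators

noncomputable section

/-- The data of the lattice geometry on which constants may depend: the dimension `dim` and the
prefactor `growth` of the volume growth of balls, the ratio `ratio` between the coordinate distance
in the periodic direction and the lattice metric, and the polynomial bounding the number of sites
by the length in the periodic direction. -/
structure LatticeGeometry where
  /-- the dimension of the lattice -/
  dim : ℕ
  /-- balls of radius `r` have at most `growth * (1 + r) ^ dim` sites -/
  growth : ℝ
  /-- coordinate distance in the periodic direction is at most `ratio` times the distance -/
  ratio : ℝ
  /-- a lattice of length `L` has at most `sizeBound(L)` sites -/
  sizeBound : Polynomial ℝ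

/-- Sites of a lattice that is periodic with length `L` in one direction: the coordinate
`x ∈ ℤ/Lℤ` in that direction, and a label in the finite cross-section `M`
(transverse coordinates and position in the unit cell). -/
abbrev Site (L : ℕ) (M : Type) : Type := ZMod L × M

/-- Translation of the sites by one step in the periodic direction. -/
def siteShift {L : ℕ} {M : Type} (i : Site L M) : Site L M := (i.1 + 1, i.2)

/-- The metric `ms` makes the sites a finite-dimensional lattice, periodic of length `L` in one
direction, whose geometry is controlled by `g`. -/
structure IsPeriodicLattice (g : LatticeGeometry) (L : ℕ) [NeZero L] (M : Type) [Fintype M]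
    (ms : MetricSpace (Site L M)) : Prop where
  /-- finite-dimensionality: polynomial growth of balls -/
  card_ball_le : ∀ (i : Site L M) (r : ℝ), 0 ≤ r →
    ({j : Site L M | ms.dist i j ≤ r}.ncard : ℝ) ≤ g.growth * (1 + r) ^ g.dim
  /-- the translation is a symmetry of the lattice -/
  dist_shift : ∀ i j : Site L M, ms.dist (siteShift i) (siteShift j) = ms.dist i j
  /-- `L` is a length: the circular distance `min_n |x(i) - x(j) + nL|` is controlled by the
  lattice distance -/
  circ_le : ∀ i j : Site L M, ((i.1 - j.1).valMinAbs.natAbs : ℝ) ≤ g.ratio * ms.dist i j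
  /-- the number of sites is at most polynomial in `L` -/
  card_le : (Fintype.card (Site L M) : ℝ) ≤ g.sizeBound.eval (L : ℝ)

/-- Basis configurations: site `(x, m)` has the basis states `0, …, d m - 1`. -/
abbrev Config (L : ℕ) {M : Type} (d : M → ℕ) : Type := ∀ i : Site L M, Fin (d i.2)

/-- The many-body Hilbert space `⨂ᵢ ℂ^{d(i)}`, in its product basis. -/
abbrev ManyBody (L : ℕ) {M : Type} (d : M → ℕ) : Type := EuclideanSpace ℂ (Config L d)

section

variable {L : ℕ} [NeZero L] {M : Type} [Fintype M] [DecidableEq M] {d : M → ℕ}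

variable (L d) in
/-- Operators on the many-body Hilbert space, with the operator norm. -/
abbrev Op : Type := ManyBody L d →L[ℂ] ManyBody L d

/-- The matrix element `⟨s| A |t⟩` in the product basis. -/
def matrixElement (A : Op L d) (s t : Config L d) : ℂ :=
  A (EuclideanSpace.single t 1) s

/-- `A` is supported on `X`: `A = P ⊗ 1` for an operator `P` on the tensor product of the site
spaces in `X` and the identity on the sites outside `X`. -/
def SupportedOn (X : Finset (Site L M)) (A : Op L d) : Prop :=
  ∃ P : Matrix (∀ i : X, Fin (d i.1.2)) (∀ i : X, Fin (d i.1.2)) ℂ,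
    ∀ s t : Config L d,
      ((∀ i, i ∉ X → s i = t i) → matrixElement A s t = P (fun i => s i) (fun i => t i)) ∧
      ((∃ i, i ∉ X ∧ s i ≠ t i) → matrixElement A s t = 0)

variable (L d) in
/-- The translated configuration: the state of site `i` is moved to site `siteShift i`. -/
def configShift : Config L d ≃ Config L d where
  toFun s := fun i => s (i.1 - 1, i.2)
  invFun s := fun i => s (i.1 + 1, i.2)
  left_inv s := by
    funext i
    have h : ((i.1 + 1 - 1, i.2) : Site L M) = i := by simp
    exact eq_of_heq (congr_arg_heq s h)
  right_inv s := by
    funext i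
    have h : ((i.1 - 1 + 1, i.2) : Site L M) = i := by simp
    exact eq_of_heq (congr_arg_heq s h)

variable (L d) in
/-- The unitary translation operator `T`, which sends the basis vector `|s⟩` to the basis vector of
the translated configuration. -/
def translation : Op L d :=
  ((LinearIsometryEquiv.piLpCongrLeft 2 ℂ ℂ (configShift L d)).toContinuousLinearEquiv :
    ManyBody L d →L[ℂ] ManyBody L d)

/-- A Hamiltonian `H = ∑_Z H_Z` with Hermitian terms `H_Z` supported on `Z`, of norm at most `J`,
and vanishing when the diameter of `Z` exceeds `R`. -/
structure LocalHamiltonian (R J : ℝ) (ms : MetricSpace (Site L M)) (d : M → ℕ) where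
  /-- the interaction terms -/
  term : Finset (Site L M) → Op L d
  selfAdjoint : ∀ Z, IsSelfAdjoint (term Z)
  supported : ∀ Z, SupportedOn Z (term Z)
  norm_le : ∀ Z, ‖term Z‖ ≤ J
  range_le : ∀ Z, (∃ i ∈ Z, ∃ j ∈ Z, R < ms.dist i j) → term Z = 0

/-- The Hamiltonian as an operator. -/
def LocalHamiltonian.op {R J : ℝ} {ms : MetricSpace (Site L M)}
    (H : LocalHamiltonian R J ms d) : Op L d := ∑ Z, H.term Z

/-- Translation covariant site charges `q_i`: Hermitian operators supported on single sites, with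
integer eigenvalues and norm at most `qmax`, such that `T q_i T⁻¹` is the charge of the translated
site. -/
structure SiteCharge (qmax : ℝ) (L : ℕ) [NeZero L] (d : M → ℕ) where
  /-- the charge of a site -/
  q : Site L M → Op L d
  selfAdjoint : ∀ i, IsSelfAdjoint (q i)
  supported : ∀ i, SupportedOn {i} (q i)
  integer : ∀ (i : Site L M) (μ : ℂ),
    Module.End.HasEigenvalue (q i : ManyBody L d →ₗ[ℂ] ManyBody L d) μ → ∃ n : ℤ, μ = n
  norm_le : ∀ i, ‖q i‖ ≤ qmax
  covariant : ∀ i, translation L d * q i = q (siteShift i) * translation L d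

/-- The total charge `Q = ∑_i q_i`. -/
def SiteCharge.total {qmax : ℝ} (q : SiteCharge qmax L d) : Op L d := ∑ i, q.q i

/-- The energy levels of `H`, that is, its (real) eigenvalues. -/
def energies (H : Op L d) : Set ℝ :=
  {E : ℝ | Module.End.HasEigenvalue (H : ManyBody L d →ₗ[ℂ] ManyBody L d) (E : ℂ)}

/-- `ψ` is a normalized ground state of `H`, with ground state energy `E₀`. -/
structure IsGroundState (H : Op L d) (E₀ : ℝ) (ψ : ManyBody L d) : Prop where
  isLeast : IsLeast (energies H) E₀
  eigen : H ψ = (E₀ : ℂ) • ψ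
  norm_eq : ‖ψ‖ = 1

/-- The energy level `E` of `H` is degenerate. -/
def IsDegenerate (H : Op L d) (E : ℝ) : Prop :=
  2 ≤ Module.finrank ℂ
    (Module.End.eigenspace (H : ManyBody L d →ₗ[ℂ] ManyBody L d) (E : ℂ))

/-- `E₁` is the energy of the first excited state above the ground state energy `E₀`. -/
def IsFirstExcited (H : Op L d) (E₀ E₁ : ℝ) : Prop :=
  IsLeast {E : ℝ | E ∈ energies H ∧ E₀ < E} E₁

end

end

/-! Suppose that the ground state `ψ` is nondegenerate and that the gap `γ` exceeds a large multiple
of log L / L. The plan is to twist `ψ` by the charge of the half 0 ≤ x < L/2 and to show that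
exp(-2πiρ) is within less than 4/L of 1. The total charge of `ψ` is an integer, so ρ is a multiple
of 1/L. If ρ is not an integer, `four_div_le_norm_exp_sub_one` gives distance at least 4/L, a
contradiction.

The half charge does not have `ψ` as an eigenvector, but its Heisenberg evolution averaged over a
time filter nearly does: the average multiplies the matrix element to an eigenstate of excitation
energy ω by the Fourier transform of the filter at ω, which is tiny for ω ≥ γ
(`IsGapped.norm_timeAverage_apply_sub_le`). The filter lives on times |t| ≤ T with T proportional to
L. By charge conservation only terms near the cuts x = 0 and x = L/2 move the half charge, so
Lieb–Robinson bounds replace the average by G = D₁ + D₂ + S, with D₁ and D₂ localized near the two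
cuts and S a bulk charge with integer spectrum (`IsFiniteRange.norm_evol_sub_evol_le`).

Now exp(2πiG) = V₁V₂ with V₁ and V₂ localized at opposite cuts, and `ψ` is nearly an eigenvector of
this product. Hence V₁ acts on `ψ` like an operator localized far away. `IsGapped.norm_apply_sub_le`
turns this into V₁ψ ≈ vψ: such an operator cannot create energy, and the gap then forbids any
excitation.

Translating G by one column adds an operator a₁ near one cut and a₂ near the other. As (a₁ + a₂)ψ ≈
0, the same principle gives a₁ψ ≈ αψ, and translation invariance gives α = -ρ. Adding only a₁ moves
just the first cut, so exp(2πi(G + a₁)) = V₂W with W the translate of V₁. Since Wψ ≈ vψ as well, V₂W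
and V₂V₁ agree on `ψ`; comparing phases gives exp(2πiα) ≈ 1 (`IsGapped.norm_exp_sub_one_le`).

All errors are a power of L times the filter error or the Lieb–Robinson tail. Both are below any
fixed inverse power of L once Tγ is a large multiple of log L, which is where log L / L comes from.
Bounded L is covered by the trivial bound 2‖H‖ on the gap. -/

noncomputable section

/-! ### Heisenberg evolution and Lieb–Robinson bounds in a unital C⋆-algebra -/

namespace Heisenberg

open NormedSpace

variable {𝔸 : Type*} [CStarAlgebra 𝔸]

/-- The one-parameter group `exp (i t H)`. -/
def propagator (H : 𝔸) (t : ℝ) : 𝔸 := exp (t • (Complex.I • H))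

/-- The Heisenberg evolution `exp (i t H) A exp (-i t H)`. -/
def evol (H : 𝔸) (t : ℝ) (A : 𝔸) : 𝔸 := propagator H t * A * propagator H (-t)

@[simp] lemma propagator_zero (H : 𝔸) : propagator H 0 = 1 := by
  simp [propagator]

lemma propagator_add (H : 𝔸) (s t : ℝ) :
    propagator H (s + t) = propagator H s * propagator H t := by
  let _ : NormedAlgebra ℚ 𝔸 := NormedAlgebra.restrictScalars ℚ ℂ 𝔸
  rw [propagator, add_smul, exp_add_of_commute]; rfl
  exact ((Commute.refl _).smul_left _).smul_right _

@[simp] lemma propagator_mul_neg (H : 𝔸) (t : ℝ) : propagator H t * propagator H (-t) = 1 := by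
  rw [← propagator_add]; simp

@[simp] lemma propagator_neg_mul (H : 𝔸) (t : ℝ) : propagator H (-t) * propagator H t = 1 := by
  rw [← propagator_add]; simp

lemma propagator_neg_left (H : 𝔸) (t : ℝ) : propagator (-H) t = propagator H (-t) := by
  simp [propagator]

lemma star_propagator {H : 𝔸} (hH : IsSelfAdjoint H) (t : ℝ) :
    star (propagator H t) = propagator H (-t) := by
  rw [propagator, star_exp, propagator]
  congr 1
  simp [star_smul, hH.star_eq]

lemma propagator_mem_unitary {H : 𝔸} (hH : IsSelfAdjoint H) (t : ℝ) :
    propagator H t ∈ unitary 𝔸 := by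
  rw [Unitary.mem_iff, star_propagator hH]; simp

lemma commute_propagator {H A : 𝔸} (h : Commute H A) (t : ℝ) : Commute (propagator H t) A :=
  (Commute.exp_right (((h.symm).smul_right _).smul_right _)).symm

lemma hasDerivAt_propagator (H : 𝔸) (t : ℝ) :
    HasDerivAt (propagator H) (propagator H t * (Complex.I • H)) t :=
  hasDerivAt_exp_smul_const (𝕂 := ℝ) (Complex.I • H) t

lemma hasDerivAt_propagator_neg (H : 𝔸) (t : ℝ) :
    HasDerivAt (fun s => propagator H (-s)) (-((Complex.I • H) * propagator H (-t))) t := by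
  have h := hasDerivAt_propagator (-H) t
  simp only [funext fun s => propagator_neg_left H s] at h
  refine h.congr_deriv ?_
  rw [smul_neg, mul_neg, ((commute_propagator (Commute.refl H) (-t)).smul_right _).eq]

lemma continuous_propagator (H : 𝔸) : Continuous (propagator H) :=
  continuous_iff_continuousAt.2 fun t => (hasDerivAt_propagator H t).continuousAt

@[simp] lemma evol_zero (H A : 𝔸) : evol H 0 A = A := by simp [evol]

lemma evol_add (H : 𝔸) (t : ℝ) (A B : 𝔸) : evol H t (A + B) = evol H t A + evol H t B := by
  simp [evol, mul_add, add_mul]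

lemma evol_sub (H : 𝔸) (t : ℝ) (A B : 𝔸) : evol H t (A - B) = evol H t A - evol H t B := by
  simp [evol, mul_sub, sub_mul]

lemma evol_smul (H : 𝔸) (t : ℝ) (c : ℂ) (A : 𝔸) : evol H t (c • A) = c • evol H t A := by
  simp [evol]

lemma evol_sum {ι : Type*} (s : Finset ι) (H : 𝔸) (t : ℝ) (A : ι → 𝔸) :
    evol H t (∑ i ∈ s, A i) = ∑ i ∈ s, evol H t (A i) := by
  simp [evol, Finset.mul_sum, Finset.sum_mul]

lemma evol_mul (H : 𝔸) (t : ℝ) (A B : 𝔸) : evol H t (A * B) = evol H t A * evol H t B := by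
  simp only [evol]
  rw [show propagator H t * A * propagator H (-t) * (propagator H t * B * propagator H (-t)) =
    propagator H t * A * (propagator H (-t) * propagator H t) * B * propagator H (-t) by
      simp only [mul_assoc]]
  simp [mul_assoc]

lemma evol_evol (H : 𝔸) (s t : ℝ) (A : 𝔸) : evol H s (evol H t A) = evol H (s + t) A := by
  simp only [evol]
  rw [propagator_add, show -(s + t) = -t + -s by ring, propagator_add]
  simp only [mul_assoc]

lemma evol_neg_left (H : 𝔸) (t : ℝ) (A : 𝔸) : evol (-H) t A = evol H (-t) A := by
  simp [evol, propagator_neg_left]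

lemma evol_of_commute {H A : 𝔸} (h : Commute H A) (t : ℝ) : evol H t A = A := by
  rw [evol, (commute_propagator h t).eq, mul_assoc]; simp

lemma propagator_add_left {H K : 𝔸} (hHK : Commute H K) (t : ℝ) :
    propagator (H + K) t = propagator H t * propagator K t := by
  let _ : NormedAlgebra ℚ 𝔸 := NormedAlgebra.restrictScalars ℚ ℂ 𝔸
  rw [propagator, smul_add, smul_add, exp_add_of_commute]; rfl
  exact (((hHK.smul_left _).smul_left _).smul_right _).smul_right _

lemma propagator_conj {T : 𝔸} (hT : T ∈ unitary 𝔸) (H : 𝔸) (t : ℝ) :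
    propagator (T * H * star T) t = T * propagator H t * star T := by
  let _ : NormedAlgebra ℚ 𝔸 := NormedAlgebra.restrictScalars ℚ ℂ 𝔸
  have h := exp_units_conj (⟨T, star T, (Unitary.mem_iff.1 hT).2, (Unitary.mem_iff.1 hT).1⟩ : 𝔸ˣ) (t • (Complex.I • H))
  simpa [propagator, smul_mul_assoc, mul_smul_comm] using h

/-- The propagator of the sum factorizes and the factor of `K` cancels. This separates the dynamics
at the two cuts, and keeps terms local when they are averaged over the total charge. -/
lemma evol_add_of_commute {H K A : 𝔸} (hHK : Commute H K) (hKA : Commute K A) (t : ℝ) :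
    evol (H + K) t A = evol H t A := by
  have h' : Commute (propagator K (-t)) (propagator H (-t)) :=
    (commute_propagator (commute_propagator hHK (-t)).symm (-t))
  rw [evol, propagator_add_left hHK, propagator_add_left hHK, ← h'.eq]
  rw [show propagator H t * propagator K t * A * (propagator K (-t) * propagator H (-t)) =
    propagator H t * (propagator K t * A) * propagator K (-t) * propagator H (-t) by
      simp only [mul_assoc], (commute_propagator hKA t).eq]
  rw [show propagator H t * (A * propagator K t) * propagator K (-t) * propagator H (-t) =
    propagator H t * A * (propagator K t * propagator K (-t)) * propagator H (-t) by
      simp only [mul_assoc]]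
  simp [evol]

lemma norm_evol {H : 𝔸} (hH : IsSelfAdjoint H) (t : ℝ) (A : 𝔸) : ‖evol H t A‖ = ‖A‖ := by
  rw [evol, CStarRing.norm_mul_mem_unitary _ (propagator_mem_unitary hH _),
    CStarRing.norm_mem_unitary_mul _ (propagator_mem_unitary hH _)]

lemma star_evol {H : 𝔸} (hH : IsSelfAdjoint H) (t : ℝ) (A : 𝔸) :
    star (evol H t A) = evol H t (star A) := by
  simp [evol, star_mul, star_propagator hH, mul_assoc]

lemma isSelfAdjoint_evol {H A : 𝔸} (hH : IsSelfAdjoint H) (hA : IsSelfAdjoint A) (t : ℝ) :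
    IsSelfAdjoint (evol H t A) := by
  rw [IsSelfAdjoint, star_evol hH, hA.star_eq]

lemma continuous_evol (H A : 𝔸) : Continuous (fun t => evol H t A) :=
  ((continuous_propagator H).mul continuous_const).mul
    ((continuous_propagator H).comp continuous_neg)

lemma hasDerivAt_evol (H A : 𝔸) (t : ℝ) :
    HasDerivAt (fun s => evol H s A) (evol H t (Complex.I • (H * A - A * H))) t := by
  have h := ((hasDerivAt_propagator H t).mul_const A).mul (hasDerivAt_propagator_neg H t)
  refine h.congr_deriv ?_
  simp only [evol, smul_sub, mul_sub, sub_mul, mul_assoc, smul_mul_assoc, mul_smul_comm, mul_neg]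
  abel

/-- Evolving with `K` back along the evolution with `H`: the derivative of the comparison of the
two evolutions. -/
lemma hasDerivAt_evol_neg_evol (H K A : 𝔸) (t : ℝ) :
    HasDerivAt (fun s => evol K (-s) (evol H s A))
      (evol K (-t) (Complex.I • ((H - K) * evol H t A - evol H t A * (H - K)))) t := by
  have h := ((hasDerivAt_propagator_neg K t).mul (hasDerivAt_evol H A t)).mul
    (hasDerivAt_propagator K t)
  have hcomm : evol H t (Complex.I • (H * A - A * H)) =
      Complex.I • (H * evol H t A - evol H t A * H) := by
    rw [evol_smul, evol_sub, evol_mul, evol_mul, evol_of_commute (Commute.refl H)]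
  have h1 : propagator K (-t) * (Complex.I • K) = (Complex.I • K) * propagator K (-t) :=
    ((commute_propagator (Commute.refl K) (-t)).smul_right _).eq
  have h2 : propagator K t * (Complex.I • K) = (Complex.I • K) * propagator K t :=
    ((commute_propagator (Commute.refl K) t).smul_right _).eq
  refine (h.congr_deriv ?_).congr_of_eventuallyEq (Filter.Eventually.of_forall fun s => ?_)
  · rw [hcomm, ← h1, h2, evol.eq_1 K, neg_neg, Pi.mul_apply]
    simp only [smul_sub, mul_sub, sub_mul, mul_assoc, smul_mul_assoc, mul_smul_comm,
      neg_mul, add_mul]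
    abel
  · simp [evol]

/-- Duhamel's bound for the difference of two Heisenberg evolutions. -/
lemma norm_evol_sub_evol_le {H K : 𝔸} (hK : IsSelfAdjoint K) (A : 𝔸)
    {b b' : ℝ → ℝ} (hb : ∀ s, HasDerivAt b (b' s) s) {t : ℝ} (ht : 0 ≤ t)
    (hbd : ∀ s, 0 ≤ s → s ≤ t → ‖(H - K) * evol H s A - evol H s A * (H - K)‖ ≤ b' s) :
    ‖evol H t A - evol K t A‖ ≤ b t - b 0 := by
  set f : ℝ → 𝔸 := fun s => evol K (-s) (evol H s A) - A
  have hf : ∀ s, HasDerivAt f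
      (evol K (-s) (Complex.I • ((H - K) * evol H s A - evol H s A * (H - K)))) s :=
    fun s => (hasDerivAt_evol_neg_evol H K A s).sub_const A
  have key := image_norm_le_of_norm_deriv_right_le_deriv_boundary (f := f) (a := 0) (b := t)
    (B := fun s => b s - b 0) (B' := b')
    (fun s _ => (hf s).continuousAt.continuousWithinAt)
    (fun s _ => (hf s).hasDerivWithinAt) (by simp [f])
    (fun s => (hb s).sub_const _)
    (fun s hs => by
      rw [norm_evol hK, norm_smul, Complex.norm_I, one_mul]
      exact hbd s hs.1 hs.2.le) (x := t) ⟨ht, le_rfl⟩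
  have : evol H t A - evol K t A = evol K t (f t) := by
    simp [f, evol_sub, evol_evol]
  rw [this, norm_evol hK]
  exact key

lemma norm_commutator_le (A B : 𝔸) : ‖A * B - B * A‖ ≤ 2 * ‖A‖ * ‖B‖ := by
  calc ‖A * B - B * A‖ ≤ ‖A * B‖ + ‖B * A‖ := norm_sub_le _ _
    _ ≤ ‖A‖ * ‖B‖ + ‖B‖ * ‖A‖ := add_le_add (norm_mul_le _ _) (norm_mul_le _ _)
    _ = _ := by ring

/-- The commutator of an evolved operator with `B` grows only through the part of the Hamiltonian
that does not commute with that operator. -/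
lemma norm_commutator_evol_le {H K A : 𝔸} (hH : IsSelfAdjoint H) (hK : IsSelfAdjoint K)
    (hKA : Commute K A) (B : 𝔸) {b b' : ℝ → ℝ} (hb : ∀ s, HasDerivAt b (b' s) s) {t : ℝ}
    (ht : 0 ≤ t)
    (hbd : ∀ s, 0 ≤ s → s ≤ t → ‖evol H s (H - K) * B - B * evol H s (H - K)‖ ≤ b' s) :
    ‖evol H t A * B - B * evol H t A‖ ≤ ‖A * B - B * A‖ + 2 * ‖A‖ * (b t - b 0) := by
  -- The evolution is moved from `A` to `B`. The backward evolution by `K` fixes `A` and leaves the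
  -- norm of the commutator unchanged, so only the Duhamel error between the two backward evolutions
  -- of `B` contributes.
  have h1 : ‖evol (-H) t B - evol (-K) t B‖ ≤ b t - b 0 := by
    refine norm_evol_sub_evol_le hK.neg B hb ht fun s hs hst => ?_
    refine le_trans (le_of_eq ?_) (hbd s hs hst)
    have hX : evol (-H) s (evol H s (H - K) * B - B * evol H s (H - K)) =
        (H - K) * evol (-H) s B - evol (-H) s B * (H - K) := by
      rw [evol_sub, evol_mul, evol_mul, evol_neg_left H s (evol H s _), evol_evol]
      simp
    rw [← norm_evol hH.neg s (evol H s (H - K) * B - B * evol H s (H - K)), hX, ← norm_neg]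
    congr 1
    noncomm_ring
  have h2 : ‖A * evol (-H) t B - evol (-H) t B * A‖ = ‖evol H t A * B - B * evol H t A‖ := by
    rw [← norm_evol hH t (A * evol (-H) t B - evol (-H) t B * A)]
    rw [evol_sub, evol_mul, evol_mul, evol_neg_left, evol_evol]
    simp
  have h3 : ‖A * evol (-K) t B - evol (-K) t B * A‖ = ‖A * B - B * A‖ := by
    rw [← norm_evol hK.neg t (A * B - B * A), evol_sub, evol_mul, evol_mul,
      evol_of_commute hKA.neg_left]
  rw [← h2, ← h3]
  set X := evol (-H) t B
  set Y := evol (-K) t B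
  calc ‖A * X - X * A‖ = ‖(A * Y - Y * A) + (A * (X - Y) - (X - Y) * A)‖ := by
        congr 1; noncomm_ring
    _ ≤ _ := (norm_add_le _ _).trans (add_le_add le_rfl ((norm_commutator_le _ _).trans
        (mul_le_mul_of_nonneg_left h1 (by positivity))))

variable {ι : Type*} [DecidableEq ι]

/-- Lieb–Robinson bound: a term `h Z` that is `n` steps of noncommuting terms away from `B` has,
after time `t`, a commutator of order `tⁿ / n!` with `B`. -/
theorem norm_commutator_evol_term_le (s : Finset ι) (h : ι → 𝔸)
    (hself : ∀ Z ∈ s, IsSelfAdjoint (h Z)) {J : ℝ} (hJ : 0 ≤ J) (hnorm : ∀ Z ∈ s, ‖h Z‖ ≤ J)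
    (nbr : ι → Finset ι) (hsub : ∀ Z, nbr Z ⊆ s)
    (hcomm : ∀ Z ∈ s, ∀ Y ∈ s, Y ∉ nbr Z → Commute (h Y) (h Z))
    {N : ℝ} (hcard : ∀ Z ∈ s, ((nbr Z).card : ℝ) ≤ N) (B : 𝔸)
    (far : ℕ → ι → Prop) (hfar_nbr : ∀ n, ∀ Z ∈ s, far (n + 1) Z → ∀ Y ∈ nbr Z, far n Y)
    (hfar_comm : ∀ n, ∀ Z ∈ s, far (n + 1) Z → Commute (h Z) B)
    (n : ℕ) (Z : ι) (hZ : Z ∈ s) (hfar : far n Z) {t : ℝ} (ht : 0 ≤ t) :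
    ‖evol (∑ Y ∈ s, h Y) t (h Z) * B - B * evol (∑ Y ∈ s, h Y) t (h Z)‖ ≤
      2 * J * ‖B‖ * ((2 * J * N * t) ^ n / n.factorial) := by
  set H := ∑ Y ∈ s, h Y with hHdef
  have hH : IsSelfAdjoint H := isSelfAdjoint_sum _ hself
  induction n generalizing Z t with
  | zero =>
    refine (norm_commutator_le _ _).trans ?_
    rw [norm_evol hH]
    have := hnorm Z hZ
    simp only [pow_zero, Nat.factorial_zero, Nat.cast_one, div_one, mul_one]
    gcongr
  | succ n ih =>
    -- Only the neighbours of `Z` drive the growth. Each is one step closer to `B`, and integrating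
    -- their bound in time raises the power by one.
    set K := ∑ Y ∈ s \ nbr Z, h Y
    have hHK : H - K = ∑ Y ∈ nbr Z, h Y := by
      rw [hHdef, ← Finset.sum_sdiff (hsub Z)]; simp [K]
    have hK : IsSelfAdjoint K :=
      isSelfAdjoint_sum _ fun Y hY => hself Y (Finset.mem_sdiff.1 hY).1
    have hKA : Commute K (h Z) := Commute.sum_left _ _ _ fun Y hY =>
      hcomm Z hZ Y (Finset.mem_sdiff.1 hY).1 (Finset.mem_sdiff.1 hY).2
    have hb : ∀ u : ℝ, HasDerivAt
        (fun u => ‖B‖ * ((2 * J * N * u) ^ (n + 1) / (n + 1).factorial))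
        (2 * J * N * ‖B‖ * ((2 * J * N * u) ^ n / n.factorial)) u := fun u => by
      have h1 := (((hasDerivAt_id u).const_mul (2 * J * N)).pow (n + 1)).div_const
        ((n + 1).factorial : ℝ)
      refine (h1.const_mul ‖B‖).congr_deriv ?_
      rw [Nat.factorial_succ]
      push_cast
      have : (n.factorial : ℝ) ≠ 0 := by positivity
      simp only [id]
      field_simp
    have key := norm_commutator_evol_le hH hK hKA B hb ht fun u hu _ => by
      have hN : 0 ≤ N := le_trans (by positivity) (hcard Z hZ)
      rw [hHK, evol_sum, Finset.sum_mul, Finset.mul_sum, ← Finset.sum_sub_distrib]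
      calc _ ≤ ∑ Y ∈ nbr Z, ‖evol H u (h Y) * B - B * evol H u (h Y)‖ := norm_sum_le _ _
        _ ≤ ∑ Y ∈ nbr Z, 2 * J * ‖B‖ * ((2 * J * N * u) ^ n / n.factorial) :=
          Finset.sum_le_sum fun Y hY => ih Y (hsub Z hY) (hfar_nbr n Z hZ hfar Y hY) hu
        _ = ((nbr Z).card : ℝ) * (2 * J * ‖B‖ * ((2 * J * N * u) ^ n / n.factorial)) := by
          simp
        _ ≤ N * (2 * J * ‖B‖ * ((2 * J * N * u) ^ n / n.factorial)) := by
          gcongr; exact hcard Z hZ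
        _ = _ := by ring
    refine key.trans ?_
    have hN : 0 ≤ N := le_trans (by positivity) (hcard Z hZ)
    rw [(hfar_comm n Z hZ hfar).eq, sub_self, norm_zero, zero_add]
    simp only [mul_zero, ne_eq, Nat.add_eq_zero_iff, one_ne_zero, and_false, not_false_eq_true,
      zero_pow, zero_div, sub_zero]
    have := hnorm Z hZ
    calc _ ≤ 2 * J * (‖B‖ * ((2 * J * N * t) ^ (n + 1) / (n + 1).factorial)) := by gcongr
      _ = _ := by ring

/-- Lieb–Robinson bound for an operator `A` that fails to commute only with the terms of the
Hamiltonian in `S`, all of which are far from `B`. -/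
theorem norm_commutator_evol_le_of_far (s : Finset ι) (h : ι → 𝔸)
    (hself : ∀ Z ∈ s, IsSelfAdjoint (h Z)) {J : ℝ} (hJ : 0 ≤ J) (hnorm : ∀ Z ∈ s, ‖h Z‖ ≤ J)
    (nbr : ι → Finset ι) (hsub : ∀ Z, nbr Z ⊆ s)
    (hcomm : ∀ Z ∈ s, ∀ Y ∈ s, Y ∉ nbr Z → Commute (h Y) (h Z))
    {N : ℝ} (hN : 0 ≤ N) (hcard : ∀ Z ∈ s, ((nbr Z).card : ℝ) ≤ N) (A B : 𝔸)
    (hAB : Commute A B)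
    (far : ℕ → ι → Prop) (hfar_nbr : ∀ n, ∀ Z ∈ s, far (n + 1) Z → ∀ Y ∈ nbr Z, far n Y)
    (hfar_comm : ∀ n, ∀ Z ∈ s, far (n + 1) Z → Commute (h Z) B)
    (n : ℕ) (hA : ∀ Z ∈ s, ¬ far n Z → Commute (h Z) A) {t T : ℝ} (ht : 0 ≤ t) (htT : t ≤ T) :
    ‖evol (∑ Y ∈ s, h Y) t A * B - B * evol (∑ Y ∈ s, h Y) t A‖ ≤
      2 * ‖A‖ * (T * (s.card * (2 * J * ‖B‖ * ((2 * J * N * T) ^ n / n.factorial)))) := by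
  classical
  set H := ∑ Y ∈ s, h Y with hHdef
  have hH : IsSelfAdjoint H := isSelfAdjoint_sum _ hself
  set c := (s.card * (2 * J * ‖B‖ * ((2 * J * N * T) ^ n / n.factorial)) : ℝ) with hc
  have hc0 : 0 ≤ c := by have := ht.trans htT; positivity
  set K := ∑ Y ∈ s with ¬ far n Y, h Y
  have hHK : H - K = ∑ Y ∈ s with far n Y, h Y := by
    rw [hHdef, ← Finset.sum_filter_add_sum_filter_not s (far n)]; simp [K]
  have hK : IsSelfAdjoint K :=
    isSelfAdjoint_sum _ fun Y hY => hself Y (Finset.mem_filter.1 hY).1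
  have hKA : Commute K A := Commute.sum_left _ _ _ fun Y hY =>
    hA Y (Finset.mem_filter.1 hY).1 (Finset.mem_filter.1 hY).2
  have key := norm_commutator_evol_le hH hK hKA B (b := fun u => u * c) (b' := fun _ => c)
    (fun u => by simpa using (hasDerivAt_id u).mul_const c) ht fun u hu hut => by
      rw [hHK, evol_sum, Finset.sum_mul, Finset.mul_sum, ← Finset.sum_sub_distrib]
      calc _ ≤ ∑ Y ∈ s with far n Y, ‖evol H u (h Y) * B - B * evol H u (h Y)‖ := norm_sum_le _ _
        _ ≤ ∑ Y ∈ s with far n Y, 2 * J * ‖B‖ * ((2 * J * N * T) ^ n / n.factorial) :=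
          Finset.sum_le_sum fun Y hY => by
            refine (norm_commutator_evol_term_le s h hself hJ hnorm nbr hsub hcomm hcard B far
              hfar_nbr hfar_comm n Y (Finset.mem_filter.1 hY).1 (Finset.mem_filter.1 hY).2
              hu).trans ?_
            have := hut.trans htT
            gcongr
        _ = ((s.filter (far n)).card : ℝ) *
            (2 * J * ‖B‖ * ((2 * J * N * T) ^ n / n.factorial)) := by simp
        _ ≤ c := by
          have := ht.trans htT
          rw [hc]
          gcongr
          exact Finset.filter_subset _ _
  refine key.trans ?_
  rw [hAB.eq, sub_self, norm_zero, zero_add]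
  gcongr
  simp only [zero_mul, sub_zero]
  gcongr

end Heisenberg

end

noncomputable section

namespace Heisenberg

open NormedSpace MeasureTheory

/-! ### Filter functions of compact support -/

/-- The integral of the character over an interval has modulus at most 2/|ω|, whatever the length;
the density contributes 1/(2a). Convolution powers then decay as fast as desired while keeping
compact support. -/
lemma norm_charFun_uniform_le {a : ℝ} (ha : 0 < a) {ω : ℝ} (hω : ω ≠ 0) :
    ‖charFun (ENNReal.ofReal (1 / (2 * a)) • volume.restrict (Set.Ioc (-a) a)) ω‖ ≤
      1 / (a * |ω|) := by
  have h2a : (0 : ℝ) ≤ 1 / (2 * a) := by positivity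
  have hI : ∫ x in Set.Ioc (-a) a, Complex.exp (ω * x * Complex.I) =
      (Complex.exp (ω * Complex.I * a) - Complex.exp (ω * Complex.I * (-a : ℝ))) /
        (ω * Complex.I) := by
    rw [← integral_exp_mul_complex (by simp [hω]),
      intervalIntegral.integral_of_le (by linarith)]
    refine integral_congr_ae (Filter.Eventually.of_forall fun x => ?_)
    simp only
    congr 1; ring
  rw [charFun_apply_real, integral_smul_measure, hI, ENNReal.toReal_ofReal h2a, norm_smul,
    Real.norm_of_nonneg h2a, norm_div]
  have h1 : ∀ x : ℝ, ‖Complex.exp (ω * Complex.I * x)‖ = 1 := fun x => by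
    rw [show (ω * Complex.I * x : ℂ) = ((ω * x : ℝ) : ℂ) * Complex.I by push_cast; ring,
      Complex.norm_exp_ofReal_mul_I]
  have h3 : ‖Complex.exp (ω * Complex.I * a) - Complex.exp (ω * Complex.I * (-a : ℝ))‖ ≤ 2 :=
    (norm_sub_le _ _).trans (by rw [h1, h1]; norm_num)
  have hω' : 0 < |ω| := abs_pos.2 hω
  rw [norm_mul, Complex.norm_I, mul_one, Complex.norm_real, Real.norm_eq_abs]
  calc _ ≤ 1 / (2 * a) * (2 / |ω|) := by gcongr
    _ = _ := by field_simp

/-- Probability measures on `[-n a, n a]` whose Fourier transform decays like `(a |ω|)⁻ⁿ`. -/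
lemma exists_filter_measure {a : ℝ} (ha : 0 < a) (n : ℕ) :
    ∃ μ : Measure ℝ, IsProbabilityMeasure μ ∧ (∀ᵐ t ∂μ, |t| ≤ n * a) ∧
      ∀ ω : ℝ, ω ≠ 0 → ‖charFun μ ω‖ ≤ (1 / (a * |ω|)) ^ n := by
  induction n with
  | zero =>
    refine ⟨Measure.dirac 0, inferInstance, ?_, fun ω _ => ?_⟩
    · rw [ae_dirac_iff (measurableSet_le (by fun_prop) (by fun_prop))]; simp
    · simp
  | succ n ih =>
    obtain ⟨μ, hμ, hsupp, hdec⟩ := ih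
    set ν : Measure ℝ := ENNReal.ofReal (1 / (2 * a)) • volume.restrict (Set.Ioc (-a) a)
    have hν : IsProbabilityMeasure ν := ⟨by
      simp only [ν, Measure.smul_apply, Measure.restrict_apply_univ, Real.volume_Ioc, smul_eq_mul]
      rw [← ENNReal.ofReal_mul (by positivity), ← ENNReal.ofReal_one]
      congr 1
      field_simp
      ring⟩
    have hνs : ∀ᵐ t ∂ν, |t| ≤ a := by
      refine Measure.ae_smul_measure ?_ _
      filter_upwards [ae_restrict_mem measurableSet_Ioc] with t ht
      exact abs_le.2 ⟨ht.1.le, ht.2⟩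
    refine ⟨μ.conv ν, inferInstance, ?_, fun ω hω => ?_⟩
    · rw [Measure.conv, ae_map_iff (by fun_prop) (measurableSet_le (by fun_prop) (by fun_prop))]
      filter_upwards [Measure.quasiMeasurePreserving_fst.ae hsupp,
        Measure.quasiMeasurePreserving_snd.ae hνs] with p h1 h2
      push_cast
      calc _ ≤ |p.1| + |p.2| := abs_add_le _ _
        _ ≤ _ := by linarith
    · rw [charFun_conv, norm_mul, pow_succ]
      gcongr
      · exact hdec ω hω
      · exact norm_charFun_uniform_le ha hω

section Filter

variable {𝔸 : Type*} [CStarAlgebra 𝔸] (μ : Measure ℝ)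

/-- The average of the Heisenberg evolution with weight `μ` over time. -/
def timeAverage (H A : 𝔸) : 𝔸 := ∫ t, evol H t A ∂μ

variable {μ}

lemma timeAverage_add_of_commute {H K A : 𝔸} (hHK : Commute H K) (hKA : Commute K A) :
    timeAverage μ (H + K) A = timeAverage μ H A := by
  simp [timeAverage, evol_add_of_commute hHK hKA]

variable [IsProbabilityMeasure μ]

lemma integrable_evol {H : 𝔸} (hH : IsSelfAdjoint H) (A : 𝔸) :
    Integrable (fun t => evol H t A) μ :=
  Integrable.of_bound (continuous_evol H A).aestronglyMeasurable ‖A‖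
    (Filter.Eventually.of_forall fun t => (norm_evol hH t A).le)

lemma timeAverage_mem {H : 𝔸} (hH : IsSelfAdjoint H) (A : 𝔸) (V : Submodule ℝ 𝔸)
    (hV : IsClosed (V : Set 𝔸)) (h : ∀ t, evol H t A ∈ V) : timeAverage μ H A ∈ V :=
  V.convex.integral_mem hV (Filter.Eventually.of_forall h) (integrable_evol hH A)

lemma isSelfAdjoint_timeAverage {H A : 𝔸} (hH : IsSelfAdjoint H) (hA : IsSelfAdjoint A) :
    IsSelfAdjoint (timeAverage μ H A) := by
  have := timeAverage_mem (μ := μ) hH A (selfAdjoint.submodule ℝ 𝔸)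
    (isClosed_eq continuous_star continuous_id) fun t => isSelfAdjoint_evol hH hA t
  exact this

lemma norm_timeAverage_le {H : 𝔸} (hH : IsSelfAdjoint H) (A : 𝔸) :
    ‖timeAverage μ H A‖ ≤ ‖A‖ := by
  simpa [timeAverage] using norm_integral_le_of_norm_le_const (μ := μ) (f := fun t => evol H t A)
    (Filter.Eventually.of_forall fun t => (norm_evol hH t A).le)

lemma timeAverage_add {H : 𝔸} (hH : IsSelfAdjoint H) (A B : 𝔸) :
    timeAverage μ H (A + B) = timeAverage μ H A + timeAverage μ H B := by
  simp only [timeAverage, evol_add]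
  exact integral_add (integrable_evol hH A) (integrable_evol hH B)

lemma timeAverage_of_commute {H A : 𝔸} (h : Commute H A) : timeAverage μ H A = A := by
  simp [timeAverage, evol_of_commute h]

lemma norm_timeAverage_sub_le {H K : 𝔸} (hH : IsSelfAdjoint H) (hK : IsSelfAdjoint K) (A : 𝔸)
    {c : ℝ} (h : ∀ᵐ t ∂μ, ‖evol H t A - evol K t A‖ ≤ c) :
    ‖timeAverage μ H A - timeAverage μ K A‖ ≤ c := by
  rw [timeAverage, timeAverage, ← integral_sub (integrable_evol hH A) (integrable_evol hK A)]
  simpa using norm_integral_le_of_norm_le_const (μ := μ) h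

end Filter

/-! ### Gapped ground states -/

variable {E : Type*} [NormedAddCommGroup E] [InnerProductSpace ℂ E] [CompleteSpace E]

/-- `ψ` is a normalized eigenvector of `H` with eigenvalue `E₀`, and every eigenvector of `H` is a
multiple of `ψ` or has an eigenvalue of at least `E₀ + γ`. -/
structure IsGapped (H : E →L[ℂ] E) (ψ : E) (E₀ γ : ℝ) : Prop where
  selfAdjoint : IsSelfAdjoint H
  eigen : H ψ = (E₀ : ℂ) • ψ
  norm_eq : ‖ψ‖ = 1
  pos : 0 < γ
  gap : ∀ (e : ℝ) (φ : E), H φ = (e : ℂ) • φ → φ = inner ℂ ψ φ • ψ ∨ E₀ + γ ≤ e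

lemma propagator_apply {H : E →L[ℂ] E} {φ : E} {e : ℝ} (h : H φ = (e : ℂ) • φ) (t : ℝ) :
    propagator H t φ = Complex.exp (t * e * Complex.I) • φ := by
  have h1 : ∀ n : ℕ, ((t • (Complex.I • H)) ^ n) φ = (t * e * Complex.I : ℂ) ^ n • φ := by
    intro n
    induction n with
    | zero => simp
    | succ n ih =>
      rw [pow_succ', mul_apply_eq_comp, ih, map_smul]
      simp only [smul_apply, h]
      rw [← Complex.coe_smul, smul_smul, smul_smul, smul_smul]
      congr 1; ring
  have h2 := (exp_series_hasSum_exp' (𝕂 := ℂ) (t • (Complex.I • H))).mapL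
    (ContinuousLinearMap.apply ℂ E φ)
  have h3 := (exp_series_hasSum_exp' (𝕂 := ℂ) (t * e * Complex.I : ℂ)).smul_const φ
  rw [← Complex.exp_eq_exp_ℂ] at h3
  refine h2.unique (h3.congr_fun ?_)
  intro n
  simp [h1, smul_smul]

/-- Evolution only rotates the matrix element at the energy difference, so a time average multiplies
it by the characteristic function of the filter. -/
lemma inner_evol_apply {H : E →L[ℂ] E} (hH : IsSelfAdjoint H) {ψ φ : E} {e e' : ℝ}
    (hψ : H ψ = (e : ℂ) • ψ) (hφ : H φ = (e' : ℂ) • φ) (A : E →L[ℂ] E) (t : ℝ) :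
    inner ℂ φ (evol H t A ψ) =
      Complex.exp ((e' - e : ℝ) * t * Complex.I) * inner ℂ φ (A ψ) := by
  have h1 : inner ℂ φ (evol H t A ψ) =
      inner ℂ (propagator H (-t) φ) (A (propagator H (-t) ψ)) := by
    rw [evol, ← star_propagator hH, mul_apply_eq_comp, mul_apply_eq_comp,
      ContinuousLinearMap.star_eq_adjoint, ContinuousLinearMap.adjoint_inner_left]
  rw [h1, propagator_apply hψ, propagator_apply hφ, map_smul, inner_smul_left, inner_smul_right,
    ← mul_assoc, ← Complex.exp_conj, ← Complex.exp_add]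
  congr 2
  simp
  ring

namespace IsGapped

variable {H : E →L[ℂ] E} {ψ : E} {E₀ γ : ℝ}

lemma inner_self (h : IsGapped H ψ E₀ γ) : inner ℂ ψ ψ = (1 : ℂ) := by
  rw [inner_self_eq_norm_sq_to_K, h.norm_eq]; simp

/-- The dichotomy is applied to each vector of an eigenbasis: it is either proportional to `ψ`, and
then blind to whatever has been projected off `ψ`, or orthogonal to `ψ` and above the gap. -/
lemma inner_eq_zero_or (h : IsGapped H ψ E₀ γ) {e : ℝ} {φ : E} (hφ0 : φ ≠ 0)
    (hφ : H φ = (e : ℂ) • φ) :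
    (e = E₀ ∧ ∀ χ : E, inner ℂ φ (χ - inner ℂ ψ χ • ψ) = (0 : ℂ)) ∨
      (E₀ + γ ≤ e ∧ inner ℂ φ ψ = (0 : ℂ)) := by
  by_cases hge : E₀ + γ ≤ e
  · refine Or.inr ⟨hge, ?_⟩
    have h1 : inner ℂ (H φ) ψ = inner ℂ φ (H ψ) := h.selfAdjoint.isSymmetric φ ψ
    rw [hφ, h.eigen, inner_smul_left, inner_smul_right, Complex.conj_ofReal] at h1
    have h2 : ((e - E₀ : ℝ) : ℂ) * inner ℂ φ ψ = 0 := by push_cast; rw [sub_mul, h1, sub_self]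
    rcases mul_eq_zero.1 h2 with h3 | h3
    · have := h.pos
      rw [Complex.ofReal_eq_zero] at h3
      linarith
    · exact h3
  · have hs := (h.gap e φ hφ).resolve_right hge
    refine Or.inl ⟨?_, fun χ => ?_⟩
    · have h1 : (e : ℂ) • φ = (E₀ : ℂ) • φ := by
        rw [← hφ]
        conv_lhs => rw [hs]
        rw [map_smul, h.eigen, smul_comm, ← hs]
      exact_mod_cast smul_left_injective ℂ hφ0 h1
    · rw [hs, inner_smul_left, inner_sub_right, inner_smul_right, h.inner_self]
      simp

variable [FiniteDimensional ℂ E]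

/-- The spectral gap bounds the energy of a vector from below. -/
lemma le_energy (h : IsGapped H ψ E₀ γ) (χ : E) :
    γ * ‖χ - inner ℂ ψ χ • ψ‖ ^ 2 ≤ (inner ℂ χ (H χ)).re - E₀ * ‖χ‖ ^ 2 := by
  have hsym := h.selfAdjoint.isSymmetric
  set b := hsym.eigenvectorBasis rfl
  set e := hsym.eigenvalues rfl
  have hb : ∀ i, H (b i) = (e i : ℂ) • b i := fun i => hsym.apply_eigenvectorBasis rfl i
  have hE : (inner ℂ χ (H χ)).re = ∑ i, e i * ‖inner ℂ (b i) χ‖ ^ 2 := by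
    rw [← b.sum_inner_mul_inner, Complex.re_sum]
    refine Finset.sum_congr rfl fun i _ => ?_
    have h1 : inner ℂ (b i) (H χ) = (e i : ℂ) * inner ℂ (b i) χ := by
      rw [← show inner ℂ (H (b i)) χ = inner ℂ (b i) (H χ) from hsym (b i) χ, hb, inner_smul_left,
        Complex.conj_ofReal]
    rw [h1, ← inner_conj_symm χ (b i), mul_left_comm, mul_comm (starRingEnd ℂ _), Complex.mul_conj,
      ← Complex.ofReal_mul, Complex.ofReal_re, Complex.normSq_eq_norm_sq]
  rw [hE, ← b.sum_sq_norm_inner_right χ, ← b.sum_sq_norm_inner_right, Finset.mul_sum,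
    Finset.mul_sum, ← Finset.sum_sub_distrib]
  refine Finset.sum_le_sum fun i _ => ?_
  rcases h.inner_eq_zero_or (b.orthonormal.ne_zero i) (hb i) with ⟨h1, h2⟩ | ⟨h1, h2⟩
  · rw [h2, h1]; simp
  · rw [inner_sub_right, inner_smul_right, h2, mul_zero, sub_zero, ← sub_mul]
    gcongr
    linarith

/-- Averaging an observable over time with a filter of fast decaying Fourier transform makes the
ground state an approximate eigenvector. -/
lemma norm_timeAverage_apply_sub_le (h : IsGapped H ψ E₀ γ) (μ : Measure ℝ)
    [IsProbabilityMeasure μ] {ε : ℝ} (hε : 0 ≤ ε)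
    (hμ : ∀ ω : ℝ, γ ≤ ω → ‖charFun μ ω‖ ≤ ε) (A : E →L[ℂ] E) :
    ‖timeAverage μ H A ψ - inner ℂ ψ (A ψ) • ψ‖ ≤ ε * ‖A‖ := by
  have hsym := h.selfAdjoint.isSymmetric
  set b := hsym.eigenvectorBasis rfl
  set e := hsym.eigenvalues rfl
  have hb : ∀ i, H (b i) = (e i : ℂ) • b i := fun i => hsym.apply_eigenvectorBasis rfl i
  have hf : ∀ (φ : E) (e' : ℝ), H φ = (e' : ℂ) • φ →
      inner ℂ φ (timeAverage μ H A ψ) = charFun μ (e' - E₀) * inner ℂ φ (A ψ) := by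
    intro φ e' hφ
    have h1 := ((innerSL ℂ φ).comp (ContinuousLinearMap.apply ℂ E ψ)).integral_comp_comm
      (integrable_evol (μ := μ) h.selfAdjoint A)
    simp only [ContinuousLinearMap.comp_apply, ContinuousLinearMap.apply_apply,
      innerSL_apply_apply] at h1
    rw [timeAverage, ← h1]
    simp only [inner_evol_apply h.selfAdjoint h.eigen hφ]
    rw [integral_mul_const, charFun_apply_real]
  have hψ : inner ℂ ψ (timeAverage μ H A ψ) = inner ℂ ψ (A ψ) := by
    rw [hf ψ E₀ h.eigen]; simp
  refine le_of_sq_le_sq ?_ (by positivity)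
  have hAψ : ‖A ψ‖ ≤ ‖A‖ := by simpa [h.norm_eq] using A.le_opNorm ψ
  calc _ = ∑ i, ‖inner ℂ (b i) (timeAverage μ H A ψ - inner ℂ ψ (A ψ) • ψ)‖ ^ 2 :=
        (b.sum_sq_norm_inner_right _).symm
    _ ≤ ∑ i, ε ^ 2 * ‖inner ℂ (b i) (A ψ)‖ ^ 2 := by
      refine Finset.sum_le_sum fun i _ => ?_
      rcases h.inner_eq_zero_or (b.orthonormal.ne_zero i) (hb i) with ⟨h1, h2⟩ | ⟨h1, h2⟩
      · rw [← hψ, h2]; simp; positivity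
      · rw [inner_sub_right, inner_smul_right, h2, mul_zero, sub_zero, hf _ _ (hb i), norm_mul,
          mul_pow]
        gcongr
        exact hμ _ (by linarith)
    _ = (ε * ‖A ψ‖) ^ 2 := by rw [← Finset.mul_sum, b.sum_sq_norm_inner_right, mul_pow]
    _ ≤ _ := by gcongr

end IsGapped

end Heisenberg

end

/-! ### Locality and the gap: operators that cannot excite the ground state, and the abstract twist
argument. -/

noncomputable section

namespace Heisenberg

open NormedSpace

variable {E : Type*} [NormedAddCommGroup E] [InnerProductSpace ℂ E] [CompleteSpace E]

/-- An approximate eigenvector of `G` is an approximate eigenvector of `exp (i t G)`. -/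
lemma norm_propagator_apply_sub_le {G : E →L[ℂ] E} (hG : IsSelfAdjoint G) (φ : E) (x : ℝ) {t : ℝ}
    (ht : 0 ≤ t) :
    ‖propagator G t φ - Complex.exp (t * x * Complex.I) • φ‖ ≤ t * ‖G φ - (x : ℂ) • φ‖ := by
  have hG' : IsSelfAdjoint (G - (x : ℂ) • (1 : E →L[ℂ] E)) :=
    hG.sub (IsSelfAdjoint.smul (by simp [IsSelfAdjoint]) (IsSelfAdjoint.one _))
  set K := G - (x : ℂ) • (1 : E →L[ℂ] E)
  have hGK : G = K + (x : ℂ) • (1 : E →L[ℂ] E) := by simp [K]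
  have hx : ∀ φ : E, ((x : ℂ) • (1 : E →L[ℂ] E)) φ = (x : ℂ) • φ := fun φ => by simp
  have hprop : propagator G t φ = Complex.exp (t * x * Complex.I) • propagator K t φ := by
    rw [hGK, propagator_add_left ((Commute.one_right K).smul_right _), mul_apply_eq_comp,
      propagator_apply (hx φ), map_smul]
  have hK : K φ = G φ - (x : ℂ) • φ := by simp [K]
  have key := norm_image_sub_le_of_norm_deriv_le_segment' (f := fun s => propagator K s φ)
    (f' := fun s => (propagator K s * (Complex.I • K)) φ) (a := 0) (b := t) (C := ‖K φ‖)
    (fun s _ => (((ContinuousLinearMap.apply ℂ E φ).restrictScalars ℝ).hasFDerivAt.comp_hasDerivAt s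
      (hasDerivAt_propagator K s)).hasDerivWithinAt)
    (fun s _ => by
      rw [mul_apply_eq_comp,
        ContinuousLinearMap.norm_map_of_mem_unitary (propagator_mem_unitary hG' s)]
      simp [norm_smul]) t ⟨ht, le_rfl⟩
  have h1 : ‖Complex.exp (t * x * Complex.I)‖ = 1 := by
    rw [← Complex.ofReal_mul, Complex.norm_exp_ofReal_mul_I]
  rw [hprop, ← smul_sub, norm_smul, h1, one_mul, ← hK]
  simpa [mul_comm] using key

namespace IsGapped

variable [FiniteDimensional ℂ E] {H : E →L[ℂ] E} {ψ : E} {E₀ γ : ℝ}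

/-- If the action of `a` on the ground state agrees with the action of an operator `b` that is
localized elsewhere, then `a` hardly excites the ground state. -/
theorem norm_apply_sub_le (h : IsGapped H ψ E₀ γ) {a b : E →L[ℂ] E} {ε : ℝ}
    (hab : ‖a ψ - b ψ‖ ≤ ε) (hab' : ‖star a ψ - star b ψ‖ ≤ ε)
    (hcomm : Commute (H * a - a * H) (star b)) :
    ‖a ψ - inner ℂ ψ (a ψ) • ψ‖ ≤ √(2 * ε * ‖H * a - a * H‖ / γ) := by
  set D := H * a - a * H
  have hsym := h.selfAdjoint.isSymmetric
  have hadj : ∀ (c : E →L[ℂ] E) (u v : E), inner ℂ (c u) v = inner ℂ u (star c v) := fun c u v => by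
    rw [ContinuousLinearMap.star_eq_adjoint, ContinuousLinearMap.adjoint_inner_right]
  have hD : D ψ = H (a ψ) - (E₀ : ℂ) • a ψ := by
    simp [D, h.eigen]
  -- ⟨aψ, Dψ⟩ is the excess energy of aψ, while ⟨ψ, D a*ψ⟩ is minus the excess energy of a*ψ and
  -- hence nonpositive. Replacing `a` by `b`, whose adjoint commutes with `D`, makes the two
  -- expressions equal up to 2ε‖D‖, so the excess energy of aψ is that small.
  have e1 : (inner ℂ (a ψ) (D ψ)).re = (inner ℂ (a ψ) (H (a ψ))).re - E₀ * ‖a ψ‖ ^ 2 := by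
    rw [hD, inner_sub_right, inner_smul_right, inner_self_eq_norm_sq_to_K]
    simp [← Complex.ofReal_pow]
  have e2 : (inner ℂ ψ (D (star a ψ))).re ≤ 0 := by
    have h1 := h.le_energy (star a ψ)
    have h2 : inner ℂ ψ (D (star a ψ)) =
        (E₀ : ℂ) * inner ℂ (star a ψ) (star a ψ) - inner ℂ (star a ψ) (H (star a ψ)) := by
      have h3 : inner ℂ ψ (H (a (star a ψ))) = (E₀ : ℂ) * inner ℂ ψ (a (star a ψ)) := by
        rw [← show inner ℂ (H ψ) (a (star a ψ)) = inner ℂ ψ (H (a (star a ψ))) from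
          hsym ψ (a (star a ψ)), h.eigen, inner_smul_left, Complex.conj_ofReal]
      simp only [D, sub_apply, mul_apply_eq_comp, inner_sub_right]
      rw [h3, hadj (star a), hadj (star a), star_star]
    rw [h2, inner_self_eq_norm_sq_to_K]
    have h4 : 0 ≤ γ * ‖star a ψ - inner ℂ ψ (star a ψ) • ψ‖ ^ 2 := by
      have := h.pos
      positivity
    simp only [Complex.sub_re, ← Complex.ofReal_pow, Complex.coe_algebraMap,
      ← Complex.ofReal_mul, Complex.ofReal_re]
    linarith
  have e3 : inner ℂ (b ψ) (D ψ) = inner ℂ ψ (D (star b ψ)) := by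
    rw [hadj, ← mul_apply_eq_comp (star b) D, ← hcomm.eq, mul_apply_eq_comp]
  have hDn : ∀ v : E, ‖D v‖ ≤ ‖D‖ * ‖v‖ := D.le_opNorm
  have e4 : (inner ℂ (a ψ) (D ψ)).re - (inner ℂ (b ψ) (D ψ)).re ≤ ε * ‖D‖ := by
    rw [← Complex.sub_re, ← inner_sub_left]
    refine (Complex.re_le_norm _).trans ((norm_inner_le_norm _ _).trans ?_)
    have := hDn ψ
    rw [h.norm_eq, mul_one] at this
    exact mul_le_mul hab this (norm_nonneg _) ((norm_nonneg _).trans hab)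
  have e5 : (inner ℂ ψ (D (star b ψ))).re - (inner ℂ ψ (D (star a ψ))).re ≤ ε * ‖D‖ := by
    rw [← Complex.sub_re, ← inner_sub_right, ← map_sub]
    refine (Complex.re_le_norm _).trans ((norm_inner_le_norm _ _).trans ?_)
    rw [h.norm_eq, one_mul, mul_comm]
    refine (hDn _).trans (mul_le_mul_of_nonneg_left ?_ (norm_nonneg _))
    rw [norm_sub_rev]
    exact hab'
  have e6 := h.le_energy (a ψ)
  rw [e3] at e4
  refine Real.le_sqrt_of_sq_le ?_
  rw [le_div_iff₀ h.pos]
  linarith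

/-- A twist operator argument. The generator `G = D₁ + D₂ + S` almost preserves the ground state,
its exponential factorizes into far apart pieces generated by `D₁` and `D₂`, and translating it
adds the far apart operators `a₁` and `a₂`. Then the ground state expectation of `a₁` is almost an
integer. -/
theorem norm_exp_sub_one_le (h : IsGapped H ψ E₀ γ) {T D₁ D₂ S S' a₁ a₂ : E →L[ℂ] E}
    (hT : T ∈ unitary (E →L[ℂ] E)) {lam : ℂ} (hTψ : T ψ = lam • ψ)
    (hD₁ : IsSelfAdjoint D₁) (hD₂ : IsSelfAdjoint D₂) (hS : IsSelfAdjoint S)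
    (ha₁ : IsSelfAdjoint a₁) (ha₂ : IsSelfAdjoint a₂)
    (hSexp : propagator S (2 * Real.pi) = 1) (hS'exp : propagator S' (2 * Real.pi) = 1)
    (h12 : Commute D₁ D₂) (h1S : Commute D₁ S) (h2S : Commute D₂ S)
    (h12' : Commute (T * D₁ * star T) D₂) (h1S' : Commute (T * D₁ * star T) S')
    (h2S' : Commute D₂ S')
    (hshift : T * (D₁ + D₂ + S) * star T = D₁ + D₂ + S + a₁ + a₂)
    (hadd : D₁ + D₂ + S + a₁ = T * D₁ * star T + D₂ + S')
    (hc : Commute (H * a₁ - a₁ * H) a₂)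
    (hc' : Commute (H * propagator D₁ (2 * Real.pi) - propagator D₁ (2 * Real.pi) * H)
      (propagator D₂ (2 * Real.pi)))
    {x η β : ℝ} (hG : ‖(D₁ + D₂ + S) ψ - (x : ℂ) • ψ‖ ≤ η) (hHβ : ‖H‖ ≤ β) (haβ : ‖a₁‖ ≤ β) :
    ‖Complex.exp (2 * Real.pi * (inner ℂ ψ (a₁ ψ)).re * Complex.I) - 1‖ ≤
      4 * Real.pi * η + 2 * Real.pi * √(8 * η * β ^ 2 / γ) + 2 * √(8 * Real.pi * η * β / γ) := by
  set p : ℝ := 2 * Real.pi with hp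
  have hp0 : 0 ≤ p := by positivity
  have hγ := h.pos
  have hη : 0 ≤ η := (norm_nonneg _).trans hG
  have hβ : 0 ≤ β := (norm_nonneg _).trans hHβ
  set G := D₁ + D₂ + S with hGdef
  have hGs : IsSelfAdjoint G := (hD₁.add hD₂).add hS
  have hun : ∀ {u : E →L[ℂ] E}, u ∈ unitary (E →L[ℂ] E) → ∀ v, ‖u v‖ = ‖v‖ := fun hu v =>
    ContinuousLinearMap.norm_map_of_mem_unitary hu v
  have hTT : ∀ v, star T (T v) = v := fun v => by
    rw [← mul_apply_eq_comp, (Unitary.mem_iff.1 hT).1]; rfl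
  have hlam : ‖lam‖ = 1 := by
    have := hun hT ψ
    rwa [hTψ, norm_smul, h.norm_eq, mul_one] at this
  have hTψ' : star T ψ = lam⁻¹ • ψ := by
    have h0 : lam ≠ 0 := norm_pos_iff.1 (by rw [hlam]; norm_num)
    rw [eq_inv_smul_iff₀ h0, ← map_smul, ← hTψ, hTT]
  have hconj : ∀ (X : E →L[ℂ] E) (c : ℂ),
      ‖(T * X * star T) ψ - c • ψ‖ = ‖X ψ - c • ψ‖ := fun X c => by
    have h1 : (T * X * star T) ψ - c • ψ = lam⁻¹ • T (X ψ - c • ψ) := by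
      rw [mul_apply_eq_comp, mul_apply_eq_comp, hTψ', map_smul, map_smul, map_sub, map_smul, hTψ,
        smul_sub, smul_smul _ c, smul_smul]
      congr 2
      have h0 : lam ≠ 0 := norm_pos_iff.1 (by rw [hlam]; norm_num)
      field_simp
    rw [h1, norm_smul, norm_inv, hlam, inv_one, one_mul, hun hT]
  -- the boundary operator `a₁`
  have hsum : ‖(a₁ + a₂) ψ‖ ≤ 2 * η := by
    have h1 : (a₁ + a₂) ψ = ((T * G * star T) ψ - (x : ℂ) • ψ) - (G ψ - (x : ℂ) • ψ) := by
      rw [hshift]; simp; abel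
    rw [h1]
    refine (norm_sub_le _ _).trans ?_
    rw [hconj]
    linarith
  set α : ℝ := (inner ℂ ψ (a₁ ψ)).re with hα
  have hαc : inner ℂ ψ (a₁ ψ) = (α : ℂ) := by
    refine (Complex.conj_eq_iff_re.1 ?_).symm
    rw [inner_conj_symm]
    exact ha₁.isSymmetric ψ ψ
  have h2 : ‖a₁ ψ - (α : ℂ) • ψ‖ ≤ √(8 * η * β ^ 2 / γ) := by
    have hab : ‖a₁ ψ - (-a₂) ψ‖ ≤ 2 * η := by
      rw [← sub_apply, sub_neg_eq_add]; exact hsum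
    have key := h.norm_apply_sub_le hab (by rw [ha₁.star_eq, star_neg, ha₂.star_eq]; exact hab)
      (by rw [star_neg, ha₂.star_eq]; exact hc.neg_right)
    rw [hαc] at key
    refine key.trans (Real.sqrt_le_sqrt ?_)
    have := norm_commutator_le H a₁
    have h3 : ‖H * a₁ - a₁ * H‖ ≤ 2 * β * β := this.trans (by gcongr)
    calc _ ≤ 2 * (2 * η) * (2 * β * β) / γ := by gcongr
      _ = _ := by ring
  -- the twist operators
  set V₁ := propagator D₁ p
  set V₂ := propagator D₂ p
  have hV₁ : V₁ ∈ unitary (E →L[ℂ] E) := propagator_mem_unitary hD₁ p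
  have hV₂ : V₂ ∈ unitary (E →L[ℂ] E) := propagator_mem_unitary hD₂ p
  have hVV : Commute V₁ V₂ := commute_propagator (commute_propagator h12.symm p).symm p
  have hGV : propagator G p = V₁ * V₂ := by
    rw [hGdef, propagator_add_left (h1S.add_left h2S), propagator_add_left h12, hSexp, mul_one]
  set c : ℂ := Complex.exp (p * x * Complex.I)
  have hc1 : ‖c‖ = 1 := by
    simp only [c]; rw [← Complex.ofReal_mul, Complex.norm_exp_ofReal_mul_I]
  have hVψ : ‖(V₁ * V₂) ψ - c • ψ‖ ≤ p * η := by
    rw [← hGV]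
    exact (norm_propagator_apply_sub_le hGs ψ x hp0).trans (by gcongr)
  set v : ℂ := inner ℂ ψ (V₁ ψ)
  have h3 : ‖V₁ ψ - v • ψ‖ ≤ √(8 * Real.pi * η * β / γ) := by
    -- From V₁V₂ψ ≈ cψ, the action of `V₁` on `ψ` is that of c V₂*, which lives at the other cut.
    have key := h.norm_apply_sub_le (a := V₁) (b := c • star V₂) (ε := p * η) (by
        have h1 : V₁ ψ - (c • star V₂) ψ = star V₂ ((V₁ * V₂) ψ - c • ψ) := by
          rw [hVV.eq, map_sub, map_smul, mul_apply_eq_comp, ← mul_apply_eq_comp (star V₂) V₂,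
            (Unitary.mem_iff.1 hV₂).1]
          rfl
        rw [h1, hun (Unitary.star_mem hV₂)]
        exact hVψ) (by
        have hcc : star c * c = 1 := by
          rw [Complex.star_def, mul_comm, Complex.mul_conj, Complex.normSq_eq_norm_sq, hc1]; simp
        have h1 : star V₁ ψ - star (c • star V₂) ψ = -(star c • star V₁ ((V₁ * V₂) ψ - c • ψ)) := by
          rw [map_sub, map_smul, mul_apply_eq_comp, ← mul_apply_eq_comp (star V₁) V₁,
            (Unitary.mem_iff.1 hV₁).1, smul_sub, smul_smul, hcc, star_smul, star_star]
          simp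
        rw [h1, norm_neg, norm_smul, norm_star, hc1, one_mul, hun (Unitary.star_mem hV₁)]
        exact hVψ) (by
        rw [star_smul, star_star]
        exact hc'.smul_right _)
    refine key.trans (Real.sqrt_le_sqrt ?_)
    have h4 : ‖H * V₁ - V₁ * H‖ ≤ 2 * β := by
      refine (norm_sub_le _ _).trans ?_
      rw [CStarRing.norm_mul_mem_unitary _ hV₁, CStarRing.norm_mem_unitary_mul _ hV₁]
      linarith
    calc _ ≤ 2 * (p * η) * (2 * β) / γ := by gcongr
      _ = _ := by rw [hp]; ring
  set W := T * V₁ * star T with hW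
  have hWprop : propagator (T * D₁ * star T) p = W := propagator_conj hT D₁ p
  have hWψ : ‖W ψ - v • ψ‖ ≤ √(8 * Real.pi * η * β / γ) := by rw [hW, hconj]; exact h3
  have hGW : propagator (G + a₁) p = V₂ * W := by
    rw [hadd, propagator_add_left (h1S'.add_left h2S'), add_comm, propagator_add_left h12'.symm,
      hS'exp, mul_one, hWprop]
  have hGWψ : ‖(V₂ * W) ψ - Complex.exp (p * (x + α : ℝ) * Complex.I) • ψ‖ ≤
      p * (η + √(8 * η * β ^ 2 / γ)) := by
    rw [← hGW]
    refine (norm_propagator_apply_sub_le (hGs.add ha₁) ψ (x + α) hp0).trans ?_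
    gcongr
    have h1 : (G + a₁) ψ - ((x + α : ℝ) : ℂ) • ψ =
        (G ψ - (x : ℂ) • ψ) + (a₁ ψ - (α : ℂ) • ψ) := by
      simp only [add_apply, Complex.ofReal_add, add_smul]
      abel
    rw [h1]
    exact (norm_add_le _ _).trans (add_le_add hG h2)
  -- Both `V₂ * W` and `V₁ * V₂` are compared with v V₂ψ. It is essential that `W` and `V₁` have the
  -- same approximate eigenvalue `v`; its value plays no role.
  have hfin : Complex.exp (p * (x + α : ℝ) * Complex.I) • ψ - c • ψ =
      -((V₂ * W) ψ - Complex.exp (p * (x + α : ℝ) * Complex.I) • ψ) +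
      V₂ (W ψ - v • ψ) - V₂ (V₁ ψ - v • ψ) + ((V₁ * V₂) ψ - c • ψ) := by
    rw [hVV.eq]
    simp only [map_sub, mul_apply_eq_comp]
    abel
  have hfac : Complex.exp (p * (x + α : ℝ) * Complex.I) • ψ - c • ψ =
      (c * (Complex.exp (2 * Real.pi * α * Complex.I) - 1)) • ψ := by
    rw [mul_sub, ← Complex.exp_add, mul_one, sub_smul]
    congr 3
    rw [hp]
    push_cast
    ring
  have hnorm : ‖Complex.exp (2 * Real.pi * α * Complex.I) - 1‖ =
      ‖Complex.exp (p * (x + α : ℝ) * Complex.I) • ψ - c • ψ‖ := by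
    rw [hfac, norm_smul, norm_mul, hc1, h.norm_eq, one_mul, mul_one]
  rw [hnorm, hfin]
  calc _ ≤ ‖(V₂ * W) ψ - Complex.exp (p * (x + α : ℝ) * Complex.I) • ψ‖ + ‖V₂ (W ψ - v • ψ)‖ +
        ‖V₂ (V₁ ψ - v • ψ)‖ + ‖(V₁ * V₂) ψ - c • ψ‖ := (norm_add_le _ _).trans (add_le_add ((norm_sub_le _ _).trans
        (add_le_add ((norm_add_le _ _).trans (add_le_add (norm_neg _).le le_rfl)) le_rfl)) le_rfl)
    _ ≤ p * (η + √(8 * η * β ^ 2 / γ)) + √(8 * Real.pi * η * β / γ) +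
        √(8 * Real.pi * η * β / γ) + p * η := by
      rw [hun hV₂, hun hV₂]
      gcongr
    _ = _ := by rw [hp]; ring

end IsGapped

end Heisenberg

end

noncomputable section

open Heisenberg

lemma siteShift_injective {L : ℕ} {M : Type} : Function.Injective (siteShift : Site L M → Site L M) := by
  rintro ⟨x, m⟩ ⟨y, n⟩ h
  simpa [siteShift] using h

lemma siteShift_surjective {L : ℕ} {M : Type} : Function.Surjective (siteShift : Site L M → Site L M) :=
  fun i => ⟨(i.1 - 1, i.2), by simp [siteShift]⟩

variable {L : ℕ} [NeZero L] {M : Type} [Fintype M] [DecidableEq M] {d : M → ℕ}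

/-! ### Matrix elements and local operators -/

lemma Op.ext_matrixElement {A B : Op L d}
    (h : ∀ s t, matrixElement A s t = matrixElement B s t) : A = B := by
  refine ContinuousLinearMap.coe_injective ((EuclideanSpace.basisFun (Config L d) ℂ).toBasis.ext
    fun t => ?_)
  ext s
  simpa [matrixElement] using h s t

lemma matrixElement_mul (A B : Op L d) (s t : Config L d) :
    matrixElement (A * B) s t = ∑ u, matrixElement A s u * matrixElement B u t := by
  have h : B (EuclideanSpace.single t 1) =
      ∑ u, matrixElement B u t • EuclideanSpace.single u (1 : ℂ) := by
    conv_lhs => rw [← (EuclideanSpace.basisFun (Config L d) ℂ).sum_repr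
      (B (EuclideanSpace.single t 1))]
    simp [matrixElement]
  rw [matrixElement, mul_apply_eq_comp, h, map_sum]
  simp [matrixElement, mul_comm]

lemma matrixElement_mul_of_disjoint {X Y : Finset (Site L M)} (hXY : Disjoint X Y)
    {A B : Op L d}
    {P : Matrix (∀ i : X, Fin (d i.1.2)) (∀ i : X, Fin (d i.1.2)) ℂ}
    {Q : Matrix (∀ i : Y, Fin (d i.1.2)) (∀ i : Y, Fin (d i.1.2)) ℂ}
    (hP : ∀ s t : Config L d,
      ((∀ i, i ∉ X → s i = t i) → matrixElement A s t = P (fun i : X => s i) (fun i => t i)) ∧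
      ((∃ i, i ∉ X ∧ s i ≠ t i) → matrixElement A s t = 0))
    (hQ : ∀ s t : Config L d,
      ((∀ i, i ∉ Y → s i = t i) → matrixElement B s t = Q (fun i : Y => s i) (fun i => t i)) ∧
      ((∃ i, i ∉ Y ∧ s i ≠ t i) → matrixElement B s t = 0)) (s t : Config L d) :
    ((∀ i, i ∉ X → i ∉ Y → s i = t i) → matrixElement (A * B) s t =
      P (fun i : X => s i) (fun i => t i) * Q (fun i : Y => s i) (fun i => t i)) ∧
    ((∃ i, i ∉ X ∧ i ∉ Y ∧ s i ≠ t i) → matrixElement (A * B) s t = 0) := by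
  have hd := Finset.disjoint_left.1 hXY
  rw [matrixElement_mul]
  refine ⟨fun hst => ?_, fun ⟨i, hX, hY, hi⟩ => Finset.sum_eq_zero fun u _ => ?_⟩
  -- The only intermediate configuration that contributes: `B` acts first and changes `t` only on
  -- `Y`, then `A` changes only `X`.
  · set u : Config L d := fun i => if i ∈ X then t i else s i
    rw [Finset.sum_eq_single u]
    · have h1 : ∀ i, i ∉ X → s i = u i := fun i hi => by simp [u, hi]
      have h2 : ∀ i, i ∉ Y → u i = t i := fun i hi => by
        by_cases hX : i ∈ X
        · simp [u, hX]
        · simp [u, hX, hst i hX hi]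
      rw [(hP s u).1 h1, (hQ u t).1 h2]
      congr 2
      · funext i; simp [u]
      · funext i; simp only [u, if_neg fun h => hd h i.2]
    · intro v _ hv
      by_cases h1 : ∃ i, i ∉ X ∧ s i ≠ v i
      · rw [(hP s v).2 h1, zero_mul]
      · by_cases h2 : ∃ i, i ∉ Y ∧ v i ≠ t i
        · rw [(hQ v t).2 h2, mul_zero]
        · push Not at h1 h2
          refine absurd (funext fun i => ?_) hv
          by_cases hX : i ∈ X
          · simp [u, hX, h2 i (hd hX)]
          · simp [u, hX, h1 i hX]
    · simp
  · by_cases h1 : s i = u i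
    · rw [(hQ u t).2 ⟨i, hY, h1 ▸ hi⟩, mul_zero]
    · rw [(hP s u).2 ⟨i, hX, h1⟩, zero_mul]

lemma SupportedOn.commute {X Y : Finset (Site L M)} (hXY : Disjoint X Y) {A B : Op L d}
    (hA : SupportedOn X A) (hB : SupportedOn Y B) : Commute A B := by
  obtain ⟨P, hP⟩ := hA
  obtain ⟨Q, hQ⟩ := hB
  refine Op.ext_matrixElement fun s t => ?_
  have h1 := matrixElement_mul_of_disjoint hXY hP hQ s t
  have h2 := matrixElement_mul_of_disjoint hXY.symm hQ hP s t
  by_cases h : ∀ i, i ∉ X → i ∉ Y → s i = t i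
  · rw [h1.1 h, h2.1 fun i hY hX => h i hX hY, mul_comm]
  · push Not at h
    obtain ⟨i, hX, hY, hi⟩ := h
    rw [h1.2 ⟨i, hX, hY, hi⟩, h2.2 ⟨i, hY, hX, hi⟩]

variable (d) in
/-- The algebra generated by the operators supported on finite subsets of `X`. -/
def localAlgebra (X : Set (Site L M)) : Subalgebra ℂ (Op L d) :=
  Algebra.adjoin ℂ {A | ∃ Z : Finset (Site L M), (Z : Set (Site L M)) ⊆ X ∧ SupportedOn Z A}

lemma SupportedOn.mem_localAlgebra {X : Set (Site L M)} {Z : Finset (Site L M)} {A : Op L d}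
    (hA : SupportedOn Z A) (hZ : (Z : Set (Site L M)) ⊆ X) : A ∈ localAlgebra d X :=
  Algebra.subset_adjoin ⟨Z, hZ, hA⟩

lemma localAlgebra_mono {X Y : Set (Site L M)} (h : X ⊆ Y) :
    localAlgebra d X ≤ localAlgebra d Y :=
  Algebra.adjoin_mono fun _ ⟨Z, hZ, hA⟩ => ⟨Z, hZ.trans h, hA⟩

lemma commute_of_mem_localAlgebra {X Y : Set (Site L M)} (hXY : Disjoint X Y) {A B : Op L d}
    (hA : A ∈ localAlgebra d X) (hB : B ∈ localAlgebra d Y) : Commute A B := by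
  refine Algebra.commute_of_mem_adjoin_of_forall_mem_commute hB ?_
  rintro B ⟨Z, hZ, hBZ⟩
  refine (Algebra.commute_of_mem_adjoin_of_forall_mem_commute hA ?_).symm
  rintro A ⟨W, hW, hAW⟩
  exact hBZ.commute (Finset.disjoint_coe.1 ((hXY.mono hW hZ).symm)) hAW

lemma isClosed_localAlgebra (X : Set (Site L M)) : IsClosed (localAlgebra d X : Set (Op L d)) :=
  (Subalgebra.toSubmodule (localAlgebra d X)).closed_of_finiteDimensional

lemma propagator_mem_localAlgebra {X : Set (Site L M)} {A : Op L d} (hA : A ∈ localAlgebra d X)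
    (t : ℝ) : propagator A t ∈ localAlgebra d X := by
  let _ : NormedAlgebra ℚ (Op L d) := NormedAlgebra.restrictScalars ℚ ℂ (Op L d)
  refine NormedSpace.exp_mem (s := localAlgebra d X) (isClosed_localAlgebra X) ?_
  rw [← Complex.coe_smul, smul_smul]
  exact Subalgebra.smul_mem _ hA _

lemma evol_mem_localAlgebra {X : Set (Site L M)} {H A : Op L d} (hH : H ∈ localAlgebra d X)
    (hA : A ∈ localAlgebra d X) (t : ℝ) : evol H t A ∈ localAlgebra d X :=
  mul_mem (mul_mem (propagator_mem_localAlgebra hH t) hA) (propagator_mem_localAlgebra hH (-t))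

lemma timeAverage_mem_localAlgebra {X : Set (Site L M)} {H A : Op L d} (hs : IsSelfAdjoint H)
    (hH : H ∈ localAlgebra d X) (hA : A ∈ localAlgebra d X) (μ : MeasureTheory.Measure ℝ)
    [MeasureTheory.IsProbabilityMeasure μ] : timeAverage μ H A ∈ localAlgebra d X :=
  timeAverage_mem hs A ((Subalgebra.toSubmodule (localAlgebra d X)).restrictScalars ℝ)
    (isClosed_localAlgebra X) fun t => evol_mem_localAlgebra hH hA t

/-! ### Translations -/

lemma translation_single (t : Config L d) :
    translation L d (EuclideanSpace.single t 1) = EuclideanSpace.single (configShift L d t) 1 :=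
  LinearIsometryEquiv.piLpCongrLeft_single _ _ _

lemma translation_apply (v : ManyBody L d) (s : Config L d) :
    translation L d v s = v ((configShift L d).symm s) := rfl

lemma translation_mem_unitary : translation L d ∈ unitary (Op L d) := by
  have h := (Unitary.linearIsometryEquiv.symm
    (LinearIsometryEquiv.piLpCongrLeft 2 ℂ ℂ (configShift L d))).2
  exact h

lemma star_translation_single (t : Config L d) :
    star (translation L d) (EuclideanSpace.single t 1) =
      EuclideanSpace.single ((configShift L d).symm t) 1 := by
  have h := translation_single (d := d) ((configShift L d).symm t)
  rw [Equiv.apply_symm_apply] at h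
  rw [← h, ← mul_apply_eq_comp, (Unitary.mem_iff.1 (translation_mem_unitary (L := L) (d := d))).1]
  rfl

lemma matrixElement_translation_conj (A : Op L d) (s t : Config L d) :
    matrixElement (translation L d * A * star (translation L d)) s t =
      matrixElement A ((configShift L d).symm s) ((configShift L d).symm t) := by
  rw [matrixElement, mul_apply_eq_comp, mul_apply_eq_comp, star_translation_single,
    translation_apply]
  rfl

lemma SupportedOn.translation_conj {X : Finset (Site L M)} {A : Op L d} (hA : SupportedOn X A) :
    SupportedOn (X.image siteShift) (translation L d * A * star (translation L d)) := by
  obtain ⟨P, hP⟩ := hA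
  refine ⟨fun f g => P (fun i => f ⟨siteShift i.1, Finset.mem_image_of_mem _ i.2⟩)
    (fun i => g ⟨siteShift i.1, Finset.mem_image_of_mem _ i.2⟩), fun s t => ?_⟩
  rw [matrixElement_translation_conj]
  have hn : ∀ {i : Site L M}, i ∉ X → siteShift i ∉ X.image siteShift := fun {i} hi h => by
    obtain ⟨j, hj, hji⟩ := Finset.mem_image.1 h
    exact hi (siteShift_injective hji ▸ hj)
  refine ⟨fun h => ?_, fun ⟨i, hi, hst⟩ => ?_⟩
  · exact (hP _ _).1 fun i hi => h (siteShift i) (hn hi)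
  · obtain ⟨j, rfl⟩ := siteShift_surjective i
    exact (hP _ _).2 ⟨j, fun hj => hi (Finset.mem_image_of_mem _ hj), hst⟩

/-- Translation moves the algebra of `X` to the algebra of the translated set. -/
lemma translation_conj_mem_localAlgebra {X Y : Set (Site L M)} (h : ∀ i ∈ X, siteShift i ∈ Y)
    {A : Op L d} (hA : A ∈ localAlgebra d X) :
    translation L d * A * star (translation L d) ∈ localAlgebra d Y := by
  have hT := Unitary.mem_iff.1 (translation_mem_unitary (L := L) (d := d))
  refine Algebra.adjoin_induction (p := fun A _ =>
    translation L d * A * star (translation L d) ∈ localAlgebra d Y) ?_ ?_ ?_ ?_ hA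
  · rintro A ⟨Z, hZ, hAZ⟩
    refine hAZ.translation_conj.mem_localAlgebra ?_
    intro i hi
    obtain ⟨j, hj, rfl⟩ := Finset.mem_image.1 (Finset.mem_coe.1 hi)
    exact h j (hZ hj)
  · intro r
    rw [← Algebra.commutes, mul_assoc, hT.2, mul_one]
    exact Subalgebra.algebraMap_mem _ r
  · intro A B _ _ hA hB
    rw [mul_add, add_mul]
    exact add_mem hA hB
  · intro A B _ _ hA hB
    have : translation L d * (A * B) * star (translation L d) =
        (translation L d * A * star (translation L d)) *
          (translation L d * B * star (translation L d)) := by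
      calc _ = translation L d * A * 1 * B * star (translation L d) := by
            simp only [mul_assoc, mul_one]
        _ = _ := by rw [← hT.1]; simp only [mul_assoc]
    rw [this]
    exact mul_mem hA hB

end

/-! ### Averages over the group generated by the charge, and charges of segments of columns. -/

noncomputable section

namespace Heisenberg

open MeasureTheory

section Average

variable {𝔸 : Type*} [CStarAlgebra 𝔸]

/-- The normalized Lebesgue measure on a period of the circle. -/
def circleMeasure : Measure ℝ :=
  ENNReal.ofReal (1 / (2 * Real.pi)) • volume.restrict (Set.Ioc 0 (2 * Real.pi))

instance : IsProbabilityMeasure circleMeasure := ⟨by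
  simp only [circleMeasure, Measure.smul_apply, Measure.restrict_apply_univ, Real.volume_Ioc,
    smul_eq_mul, sub_zero]
  rw [← ENNReal.ofReal_mul (by positivity), ← ENNReal.ofReal_one]
  congr 1
  have := Real.pi_pos
  field_simp⟩

lemma timeAverage_sum {μ : Measure ℝ} [IsProbabilityMeasure μ] {ι : Type*} (s : Finset ι) {H : 𝔸}
    (hH : IsSelfAdjoint H) (A : ι → 𝔸) :
    timeAverage μ H (∑ i ∈ s, A i) = ∑ i ∈ s, timeAverage μ H (A i) := by
  simp only [timeAverage, evol_sum]
  exact integral_finsetSum _ fun i _ => integrable_evol hH _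

/-- The average over a full period of the group generated by a charge commutes with the charge. -/
lemma commute_timeAverage_circleMeasure {Q : 𝔸} (hQ : IsSelfAdjoint Q)
    (hper : propagator Q (2 * Real.pi) = 1) (A : 𝔸) :
    Commute Q (timeAverage circleMeasure Q A) := by
  have hper' : propagator Q (-(2 * Real.pi)) = 1 := by
    rw [← star_propagator hQ, hper, star_one]
  have hderiv : ∀ t : ℝ, HasDerivAt (fun s => evol Q s A)
      (Complex.I • (Q * evol Q t A - evol Q t A * Q)) t := fun t => by
    refine (hasDerivAt_evol Q A t).congr_deriv ?_
    rw [evol_smul, evol_sub, evol_mul, evol_mul, evol_of_commute (Commute.refl Q)]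
  have hcont : Continuous fun t : ℝ => Complex.I • (Q * evol Q t A - evol Q t A * Q) :=
    ((continuous_const.mul (continuous_evol Q A)).sub
      ((continuous_evol Q A).mul continuous_const)).const_smul _
  -- The integrand is the derivative of a function of period 2π, and its integral is a multiple of
  -- the commutator of the charge with the average.
  have hzero : ∫ t in (0 : ℝ)..(2 * Real.pi),
      Complex.I • (Q * evol Q t A - evol Q t A * Q) = 0 := by
    rw [intervalIntegral.integral_eq_sub_of_hasDerivAt (fun t _ => hderiv t)
      (hcont.intervalIntegrable _ _)]
    simp [evol, hper, hper']
  rw [intervalIntegral.integral_of_le (by positivity), integral_smul,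
    smul_eq_zero_iff_right Complex.I_ne_zero] at hzero
  have hint := integrable_evol (μ := circleMeasure) hQ A
  have h1 : ∫ t, (Q * evol Q t A - evol Q t A * Q) ∂circleMeasure = 0 := by
    rw [circleMeasure, integral_smul_measure, hzero, smul_zero]
  rw [integral_sub (hint.const_mul Q) (hint.mul_const Q), integral_const_mul_of_integrable hint,
    integral_mul_const_of_integrable hint] at h1
  exact sub_eq_zero.1 h1

end Average

variable {E : Type*} [NormedAddCommGroup E] [InnerProductSpace ℂ E] [CompleteSpace E]

/-- Integrality of the site charges is used only in this form. Unlike a statement on eigenvalues, it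
passes to sums of commuting charges without simultaneous diagonalization. -/
lemma propagator_two_pi_eq_one [FiniteDimensional ℂ E] {A : E →L[ℂ] E} (hA : IsSelfAdjoint A)
    (hint : ∀ μ : ℂ, Module.End.HasEigenvalue (A : E →ₗ[ℂ] E) μ → ∃ n : ℤ, μ = n) :
    propagator A (2 * Real.pi) = 1 := by
  have hsym := hA.isSymmetric
  refine ContinuousLinearMap.coe_injective ((hsym.eigenvectorBasis rfl).toBasis.ext fun i => ?_)
  have hb : A (hsym.eigenvectorBasis rfl i) =
      ((hsym.eigenvalues rfl i : ℝ) : ℂ) • hsym.eigenvectorBasis rfl i :=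
    hsym.apply_eigenvectorBasis rfl i
  obtain ⟨n, hn⟩ := hint _ (hsym.hasEigenvalue_eigenvalues rfl i)
  have hexp : Complex.exp ((2 * Real.pi : ℝ) * (hsym.eigenvalues rfl i : ℝ) * Complex.I) = 1 := by
    refine Complex.exp_eq_one_iff.2 ⟨n, ?_⟩
    have hn' : ((hsym.eigenvalues rfl i : ℝ) : ℂ) = n := hn
    rw [hn']; push_cast; ring
  simp only [OrthonormalBasis.coe_toBasis, ContinuousLinearMap.coe_coe]
  rw [propagator_apply hb, hexp, one_smul]
  rfl

/-- The way back to eigenvalues, needed for the total charge and for the charge of a column. -/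
lemma exists_int_of_propagator_two_pi_eq_one {A : E →L[ℂ] E} (hA : propagator A (2 * Real.pi) = 1)
    {φ : E} (hφ : φ ≠ 0) {e : ℝ} (h : A φ = (e : ℂ) • φ) : ∃ n : ℤ, e = n := by
  have h1 := propagator_apply h (2 * Real.pi)
  rw [hA] at h1
  have h2 : Complex.exp ((2 * Real.pi : ℝ) * e * Complex.I) = 1 := by
    refine smul_left_injective ℂ hφ ?_
    simp only [one_smul]
    exact h1.symm
  obtain ⟨n, hn⟩ := Complex.exp_eq_one_iff.1 h2
  refine ⟨n, ?_⟩
  have h3 : ((e : ℝ) : ℂ) = ((n : ℝ) : ℂ) := by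
    have hp : (Real.pi : ℂ) ≠ 0 := by exact_mod_cast Real.pi_ne_zero
    have := Complex.I_ne_zero
    push_cast at hn ⊢
    have h4 : (2 * (Real.pi : ℂ) * Complex.I) * (e - n) = 0 := by linear_combination hn
    have h5 := (mul_eq_zero.1 h4).resolve_left (by simp [hp])
    linear_combination h5
  exact_mod_cast h3

end Heisenberg

open Heisenberg

variable {L : ℕ} [NeZero L] {M : Type} [Fintype M] [DecidableEq M] {d : M → ℕ} {qmax : ℝ}

lemma Op.isSelfAdjoint_sum {ι : Type*} (s : Finset ι) {A : ι → Op L d}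
    (h : ∀ i ∈ s, IsSelfAdjoint (A i)) : IsSelfAdjoint (∑ i ∈ s, A i) :=
  (selfAdjoint (Op L d)).sum_mem h

namespace SiteCharge

lemma commute_q (q : SiteCharge qmax L d) (i j : Site L M) : Commute (q.q i) (q.q j) := by
  by_cases h : i = j
  · rw [h]
  · exact (q.supported i).commute (by simpa using h) (q.supported j)

lemma q_mem_localAlgebra (q : SiteCharge qmax L d) {i : Site L M} {X : Set (Site L M)}
    (hi : i ∈ X) : q.q i ∈ localAlgebra d X :=
  (q.supported i).mem_localAlgebra (by simpa using hi)

lemma propagator_sum (q : SiteCharge qmax L d) {ι : Type*} (s : Finset ι) (f : ι → Site L M) :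
    propagator (∑ k ∈ s, q.q (f k)) (2 * Real.pi) = 1 := by
  classical
  induction s using Finset.induction_on with
  | empty => simp [propagator]
  | insert k s hk ih =>
    rw [Finset.sum_insert hk, propagator_add_left (Commute.sum_right _ _ _ fun j _ =>
      q.commute_q _ _), ih, propagator_two_pi_eq_one (q.selfAdjoint _) (q.integer _), one_mul]

lemma isSelfAdjoint_total (q : SiteCharge qmax L d) : IsSelfAdjoint q.total :=
  Op.isSelfAdjoint_sum _ fun i _ => q.selfAdjoint i

lemma translation_conj_q (q : SiteCharge qmax L d) (i : Site L M) :
    translation L d * q.q i * star (translation L d) = q.q (siteShift i) := by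
  rw [q.covariant, mul_assoc,
    (Unitary.mem_iff.1 (translation_mem_unitary (L := L) (d := d))).2, mul_one]

/-- The charge of the columns `x = a, …, b - 1`. -/
def segment (q : SiteCharge qmax L d) (a b : ℕ) : Op L d :=
  ∑ k ∈ Finset.Ico a b, ∑ m, q.q ((k : ZMod L), m)

lemma segment_eq (q : SiteCharge qmax L d) (a b : ℕ) :
    q.segment a b = ∑ p ∈ Finset.Ico a b ×ˢ (Finset.univ : Finset M), q.q ((p.1 : ZMod L), p.2) := by
  rw [segment, Finset.sum_product]

lemma isSelfAdjoint_segment (q : SiteCharge qmax L d) (a b : ℕ) : IsSelfAdjoint (q.segment a b) :=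
  Op.isSelfAdjoint_sum _ fun _ _ => Op.isSelfAdjoint_sum _ fun _ _ => q.selfAdjoint _

lemma propagator_segment (q : SiteCharge qmax L d) (a b : ℕ) :
    propagator (q.segment a b) (2 * Real.pi) = 1 := by
  rw [segment_eq]; exact q.propagator_sum _ _

lemma segment_add_segment (q : SiteCharge qmax L d) {a b c : ℕ} (hab : a ≤ b) (hbc : b ≤ c) :
    q.segment a b + q.segment b c = q.segment a c :=
  Finset.sum_Ico_consecutive _ hab hbc

lemma translation_conj_segment (q : SiteCharge qmax L d) (a b : ℕ) :
    translation L d * q.segment a b * star (translation L d) = q.segment (a + 1) (b + 1) := by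
  simp only [segment, Finset.mul_sum, Finset.sum_mul, translation_conj_q]
  rw [← Finset.sum_Ico_add']
  simp [siteShift]

lemma segment_mem_localAlgebra (q : SiteCharge qmax L d) {a b : ℕ} {X : Set (Site L M)}
    (h : ∀ k, a ≤ k → k < b → ∀ m, ((k : ZMod L), m) ∈ X) :
    q.segment a b ∈ localAlgebra d X :=
  sum_mem fun k hk => sum_mem fun m _ =>
    q.q_mem_localAlgebra (h k (Finset.mem_Ico.1 hk).1 (Finset.mem_Ico.1 hk).2 m)

lemma segment_zero_length (q : SiteCharge qmax L d) : q.segment 0 L = q.total := by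
  rw [segment_eq, SiteCharge.total]
  refine Finset.sum_bij' (fun p _ => ((p.1 : ZMod L), p.2)) (fun i _ => (i.1.val, i.2)) ?_ ?_ ?_ ?_ ?_
  · simp
  · intro i _
    simpa using ZMod.val_lt i.1
  · rintro ⟨k, m⟩ hk
    simp only [Finset.mem_product, Finset.mem_Ico, Finset.mem_univ] at hk
    simp [ZMod.val_cast_of_lt hk.1.2]
  · intro i _; simp
  · intros; rfl

lemma norm_segment_le (q : SiteCharge qmax L d) {a b : ℕ} (h : b - a ≤ L) :
    ‖q.segment a b‖ ≤ Fintype.card (Site L M) * |qmax| := by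
  rw [segment_eq]
  refine (norm_sum_le_of_le (f := fun p : ℕ × M => q.q ((p.1 : ZMod L), p.2)) _
    fun p _ => (q.norm_le _).trans (le_abs_self _)).trans ?_
  rw [Finset.sum_const, nsmul_eq_mul, Finset.card_product, Nat.card_Ico]
  gcongr
  simp only [Finset.card_univ, Fintype.card_prod, ZMod.card]
  gcongr

end SiteCharge

/-- The terms of a charge conserving Hamiltonian can be chosen to be charge conserving. -/
lemma LocalHamiltonian.exists_conserving_terms {R J : ℝ} {ms : MetricSpace (Site L M)}
    (H : LocalHamiltonian R J ms d) (q : SiteCharge qmax L d) (hqH : Commute q.total H.op) :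
    ∃ h : Finset (Site L M) → Op L d, (∀ Z, IsSelfAdjoint (h Z)) ∧
      (∀ Z : Finset (Site L M), h Z ∈ localAlgebra d (Z : Set (Site L M))) ∧ (∀ Z, ‖h Z‖ ≤ J) ∧
      (∀ Z : Finset (Site L M), (∃ i ∈ Z, ∃ j ∈ Z, R < ms.dist i j) → h Z = 0) ∧
      (∀ Z, Commute q.total (h Z)) ∧ ∑ Z, h Z = H.op := by
  have hQ := q.isSelfAdjoint_total
  refine ⟨fun Z => timeAverage circleMeasure q.total (H.term Z), fun Z => ?_, fun Z => ?_,
    fun Z => ?_, fun Z hZ => ?_, fun Z => ?_, ?_⟩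
  · exact isSelfAdjoint_timeAverage hQ (H.selfAdjoint Z)
  · have hmem : H.term Z ∈ localAlgebra d (Z : Set (Site L M)) :=
      (H.supported Z).mem_localAlgebra subset_rfl
    -- The charge outside `Z` commutes with the charge inside and with the term, so it drops out of
    -- the average, which therefore stays in the algebra of `Z`.
    have hsplit : q.total = ∑ i ∈ Z, q.q i + ∑ i ∈ Zᶜ, q.q i :=
      (Finset.sum_add_sum_compl Z _).symm
    have hin : ∑ i ∈ Z, q.q i ∈ localAlgebra d (Z : Set (Site L M)) :=
      sum_mem fun i hi => q.q_mem_localAlgebra (Finset.mem_coe.2 hi)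
    have hout : ∑ i ∈ Zᶜ, q.q i ∈ localAlgebra d (Z : Set (Site L M))ᶜ :=
      sum_mem fun i hi => q.q_mem_localAlgebra (by simpa using hi)
    simp only [hsplit]
    rw [timeAverage_add_of_commute (commute_of_mem_localAlgebra disjoint_compl_right hin hout)
      (commute_of_mem_localAlgebra disjoint_compl_left hout hmem)]
    exact timeAverage_mem_localAlgebra (Op.isSelfAdjoint_sum _ fun i _ => q.selfAdjoint i) hin hmem _
  · exact (norm_timeAverage_le hQ _).trans (H.norm_le Z)
  · simp only [H.range_le Z hZ]
    exact timeAverage_of_commute (Commute.zero_right _)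
  · refine commute_timeAverage_circleMeasure hQ ?_ _
    exact q.propagator_sum Finset.univ id
  · rw [← timeAverage_sum _ hQ]
    exact timeAverage_of_commute hqH

end

noncomputable section

open Heisenberg

/-! ### Circular distance and regions around a column -/

/-- The circular distance of `x` to the origin. -/
def circDist {L : ℕ} (x : ZMod L) : ℕ := x.valMinAbs.natAbs

section CircDist

variable {L : ℕ}

lemma circDist_add_le (x y : ZMod L) : circDist (x + y) ≤ circDist x + circDist y :=
  (ZMod.natAbs_valMinAbs_add_le x y).trans (Int.natAbs_add_le _ _)

lemma circDist_neg (x : ZMod L) : circDist (-x) = circDist x := ZMod.natAbs_valMinAbs_neg x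

lemma circDist_sub_comm (x y : ZMod L) : circDist (x - y) = circDist (y - x) := by
  rw [← neg_sub, circDist_neg]

lemma circDist_sub_le (x y z : ZMod L) :
    circDist (x - z) ≤ circDist (x - y) + circDist (y - z) := by
  simpa using circDist_add_le (x - y) (y - z)

lemma circDist_natCast {k : ℕ} (hk : k ≤ L / 2) : circDist (k : ZMod L) = k := by
  rw [circDist, ZMod.valMinAbs_natCast_of_le_half hk]; simp

lemma circDist_natCast_sub {k m : ℕ} (hkm : k ≤ m) (hm : m ≤ L / 2) :
    circDist ((k : ZMod L) - (m : ZMod L)) = m - k := by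
  rw [circDist_sub_comm, ← Nat.cast_sub hkm, circDist_natCast (by omega)]

variable [NeZero L]

lemma circDist_le_val (x : ZMod L) : circDist x ≤ x.val := by
  rw [circDist, ZMod.valMinAbs_natAbs_eq_min]; exact min_le_left _ _

/-- A short step between the two halves of the circle passes one of the two cuts. -/
lemma circDist_le_or_of_val_lt {x y : ZMod L} {r : ℕ} (hx : x.val < L / 2) (hy : L / 2 ≤ y.val)
    (h : circDist (x - y) ≤ r) : circDist x ≤ r ∨ circDist (x - ((L / 2 : ℕ) : ZMod L)) ≤ r := by
  have hyL := ZMod.val_lt y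
  have h1 : ((y.val - x.val : ℕ) : ZMod L) = y - x := by
    rw [Nat.cast_sub (by omega)]; simp
  rw [circDist_sub_comm, ← h1, circDist, ZMod.valMinAbs_natAbs_eq_min,
    ZMod.val_cast_of_lt (by omega), min_le_iff] at h
  -- The direct arc from `x` to `y` passes the cut L/2, the complementary arc passes the cut 0.
  rcases h with h | h
  · right
    have h2 : ((L / 2 - x.val : ℕ) : ZMod L) = (L / 2 : ℕ) - x := by
      rw [Nat.cast_sub (by omega)]; simp
    rw [circDist_sub_comm, ← h2]
    refine (circDist_le_val _).trans ?_
    rw [ZMod.val_cast_of_lt (by omega)]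
    omega
  · left
    exact (circDist_le_val x).trans (by omega)

end CircDist

/-- The sites within circular distance `r` of the column `c`. -/
def slab {L : ℕ} (M : Type) (c : ZMod L) (r : ℕ) : Set (Site L M) :=
  {i | circDist (i.1 - c) ≤ r}

lemma slab_mono {L : ℕ} {M : Type} {c : ZMod L} {r r' : ℕ} (h : r ≤ r') :
    slab M c r ⊆ slab M c r' :=
  fun _ hi => le_trans hi h

lemma disjoint_slab {L : ℕ} {M : Type} {c c' : ZMod L} {r r' : ℕ}
    (h : r + r' < circDist (c - c')) : Disjoint (slab M c r) (slab M c' r') := by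
  refine Set.disjoint_left.2 fun i hi hi' => ?_
  simp only [slab, Set.mem_ofPred_eq] at hi hi'
  have := circDist_sub_le c i.1 c'
  rw [circDist_sub_comm c i.1] at this
  omega

lemma disjoint_slab_cuts {L : ℕ} {M : Type} {r r' : ℕ} (h : r + r' < L / 2) :
    Disjoint (slab M (0 : ZMod L) r) (slab M ((L / 2 : ℕ) : ZMod L) r') := by
  refine disjoint_slab ?_
  rw [zero_sub, circDist_neg, circDist_natCast le_rfl]
  exact h

lemma siteShift_mem_slab {L : ℕ} {M : Type} {c : ZMod L} (hL : 2 ≤ L) {r : ℕ}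
    (i : Site L M) (hi : i ∈ slab M c r) : siteShift i ∈ slab M c (r + 1) := by
  simp only [slab, Set.mem_ofPred_eq, siteShift] at hi ⊢
  have h1 : circDist (1 : ZMod L) = 1 := by
    have := circDist_natCast (L := L) (k := 1) (by omega)
    simpa using this
  have h2 := circDist_add_le (i.1 - c) 1
  rw [show i.1 + 1 - c = i.1 - c + 1 by ring]
  omega

variable {L : ℕ} [NeZero L] {M : Type} [Fintype M] [DecidableEq M] {d : M → ℕ} {qmax : ℝ}

/-! ### Finite range Hamiltonians -/

/-- A charge conserving Hamiltonian whose terms extend over at most `ν` columns, and each of whose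
terms overlaps with at most `N` terms. -/
structure IsFiniteRange (q : SiteCharge qmax L d) (s : Finset (Finset (Site L M)))
    (h : Finset (Site L M) → Op L d) (J : ℝ) (N ν : ℕ) : Prop where
  selfAdjoint : ∀ Z, IsSelfAdjoint (h Z)
  mem : ∀ Z : Finset (Site L M), h Z ∈ localAlgebra d (Z : Set (Site L M))
  nonneg : 0 ≤ J
  norm_le : ∀ Z, ‖h Z‖ ≤ J
  conserving : ∀ Z, Commute q.total (h Z)
  extent : ∀ Z ∈ s, ∀ i ∈ Z, ∀ j ∈ Z, circDist (i.1 - j.1) ≤ ν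
  card_le : ∀ Z ∈ s, (s.filter fun Y => ¬ Disjoint Y Z).card ≤ N

namespace IsFiniteRange

variable {q : SiteCharge qmax L d} {s : Finset (Finset (Site L M))}
  {h : Finset (Site L M) → Op L d} {J : ℝ} {N ν : ℕ}

lemma neg (hH : IsFiniteRange q s h J N ν) : IsFiniteRange q s (fun Z => -h Z) J N ν where
  selfAdjoint Z := (_root_.selfAdjoint (Op L d)).neg_mem (hH.selfAdjoint Z)
  mem Z := neg_mem (hH.mem Z)
  nonneg := hH.nonneg
  norm_le Z := by rw [norm_neg]; exact hH.norm_le Z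
  conserving Z := (hH.conserving Z).neg_right
  extent := hH.extent
  card_le := hH.card_le

lemma commute_of_disjoint (hH : IsFiniteRange q s h J N ν) {Y Z : Finset (Site L M)}
    (hYZ : Disjoint Y Z) : Commute (h Y) (h Z) :=
  commute_of_mem_localAlgebra (Finset.disjoint_coe.2 hYZ) (hH.mem Y) (hH.mem Z)

lemma subset_slab (hH : IsFiniteRange q s h J N ν) {Z : Finset (Site L M)} (hZ : Z ∈ s)
    {c : ZMod L} {r : ℕ} {i : Site L M} (hi : i ∈ Z) (hic : i ∈ slab M c r) :
    (Z : Set (Site L M)) ⊆ slab M c (r + ν) := fun j hj => by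
  have h1 := hH.extent Z hZ j hj i hi
  have h2 := circDist_sub_le j.1 i.1 c
  simp only [slab, Set.mem_ofPred_eq] at hic ⊢
  omega

/-- A term that does not conserve the charge of the half `0 ≤ x < L / 2` lies near one of the
cuts. -/
lemma commute_segment_or (hH : IsFiniteRange q s h J N ν) {Z : Finset (Site L M)} (hZ : Z ∈ s) :
    Commute (h Z) (q.segment 0 (L / 2)) ∨ (Z : Set (Site L M)) ⊆ slab M 0 (ν + ν) ∨
      (Z : Set (Site L M)) ⊆ slab M ((L / 2 : ℕ) : ZMod L) (ν + ν) := by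
  by_cases h1 : ∀ i ∈ Z, L / 2 ≤ i.1.val
  · left
    refine commute_of_mem_localAlgebra (Y := {i | i.1.val < L / 2}) ?_ (hH.mem Z)
      (q.segment_mem_localAlgebra ?_)
    · refine Set.disjoint_left.2 fun i hi hi' => ?_
      have := h1 i hi
      simp only [Set.mem_ofPred_eq] at hi'
      omega
    · intro k _ hk m
      simpa [ZMod.val_cast_of_lt (show k < L by omega)] using hk
  by_cases h2 : ∀ i ∈ Z, i.1.val < L / 2
  · left
    have h3 : Commute (h Z) (q.segment (L / 2) L) := by
      refine commute_of_mem_localAlgebra (Y := {i | L / 2 ≤ i.1.val}) ?_ (hH.mem Z)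
        (q.segment_mem_localAlgebra ?_)
      · refine Set.disjoint_left.2 fun i hi hi' => ?_
        have := h2 i hi
        simp only [Set.mem_ofPred_eq] at hi'
        omega
      · intro k hk hkL m
        simpa [ZMod.val_cast_of_lt hkL] using hk
    -- A term inside the half commutes with the charge of the other half, and with the total charge,
    -- hence with their difference.
    have h4 := hH.conserving Z
    rw [← q.segment_zero_length, ← q.segment_add_segment (Nat.zero_le _) (Nat.div_le_self L 2)]
      at h4
    simpa using (h4.symm.sub_right h3)
  · right
    push Not at h1 h2
    obtain ⟨i, hi, hiv⟩ := h1
    obtain ⟨j, hj, hjv⟩ := h2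
    rcases circDist_le_or_of_val_lt hiv hjv (hH.extent Z hZ i hi j hj) with h5 | h5
    · exact Or.inl (hH.subset_slab hZ hi (by simpa [slab] using h5))
    · exact Or.inr (hH.subset_slab hZ hi h5)

/-- The commutator of the Hamiltonian with an operator localized in a slab is localized in a
slightly larger slab. -/
lemma commutator_mem_localAlgebra (hH : IsFiniteRange q s h J N ν) {c : ZMod L} {r : ℕ}
    {A : Op L d} (hA : A ∈ localAlgebra d (slab M c r)) :
    (∑ Z ∈ s, h Z) * A - A * (∑ Z ∈ s, h Z) ∈ localAlgebra d (slab M c (r + ν)) := by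
  rw [Finset.sum_mul, Finset.mul_sum, ← Finset.sum_sub_distrib]
  refine sum_mem fun Z hZ => ?_
  by_cases hd : Disjoint (Z : Set (Site L M)) (slab M c r)
  · rw [(commute_of_mem_localAlgebra hd (hH.mem Z) hA).eq, sub_self]
    exact zero_mem _
  · obtain ⟨i, hi, hic⟩ := Set.not_disjoint_iff.1 hd
    have hZ' := localAlgebra_mono (hH.subset_slab hZ hi hic) (hH.mem Z)
    have hA' : A ∈ localAlgebra d (slab M c (r + ν)) :=
      localAlgebra_mono (fun j hj => le_trans hj (Nat.le_add_right _ _)) hA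
    exact sub_mem (mul_mem hZ' hA') (mul_mem hA' hZ')

lemma norm_sum_le (hH : IsFiniteRange q s h J N ν) : ‖∑ Z ∈ s, h Z‖ ≤ s.card * J := by
  refine (norm_sum_le_of_le s fun Z _ => hH.norm_le Z).trans ?_
  simp

/-- The evolution of the half charge depends only on the terms near the cuts: bound for positive
times. -/
lemma norm_evol_sub_evol_le_of_nonneg (hH : IsFiniteRange q s h J N ν) {n : ℕ}
    (near : Finset (Finset (Site L M)))
    (hnear : ∀ Z : Finset (Site L M), Z ∈ near ↔ Z ∈ s ∧
      ((Z : Set (Site L M)) ⊆ slab M 0 ((n + 2) * ν) ∨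
      (Z : Set (Site L M)) ⊆ slab M ((L / 2 : ℕ) : ZMod L) ((n + 2) * ν)))
    {t T : ℝ} (ht : 0 ≤ t) (htT : t ≤ T) :
    ‖evol (∑ Z ∈ s, h Z) t (q.segment 0 (L / 2)) -
      evol (∑ Z ∈ near, h Z) t (q.segment 0 (L / 2))‖ ≤
      T * (s.card * (2 * ‖q.segment 0 (L / 2)‖ *
        (T * (s.card * (2 * J * J * ((2 * J * N * T) ^ n / n.factorial)))))) := by
  classical
  set A := q.segment 0 (L / 2)
  set c : ℝ := s.card * (2 * ‖A‖ *
    (T * (s.card * (2 * J * J * ((2 * J * N * T) ^ n / n.factorial))))) with hc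
  have hJ := hH.nonneg
  have hT : 0 ≤ T := ht.trans htT
  have hsub : near ⊆ s := fun Z hZ => ((hnear Z).1 hZ).1
  have hdiff : (∑ Z ∈ s, h Z) - ∑ Z ∈ near, h Z = ∑ Z ∈ s \ near, h Z := by
    rw [← Finset.sum_sdiff hsub]; simp
  have hterm : ∀ Z ∈ s \ near, ∀ u, 0 ≤ u → u ≤ T →
      ‖evol (∑ Z ∈ s, h Z) u A * h Z - h Z * evol (∑ Z ∈ s, h Z) u A‖ ≤
        2 * ‖A‖ * (T * (s.card * (2 * J * J * ((2 * J * N * T) ^ n / n.factorial)))) := by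
    intro Z hZ u hu huT
    rw [Finset.mem_sdiff, hnear] at hZ
    obtain ⟨hZs, hZn⟩ := hZ
    have hZn' := not_or.1 fun hh => hZn ⟨hZs, hh⟩
    have hνn : ν + ν ≤ (n + 2) * ν := by nlinarith
    have hmono : ∀ c : ZMod L, slab M c (ν + ν) ⊆ slab M c ((n + 2) * ν) :=
      fun c i hi => le_trans hi hνn
    have hAZ : Commute A (h Z) := by
      rcases hH.commute_segment_or hZs with h1 | h1 | h1
      · exact h1.symm
      · exact absurd (h1.trans (hmono _)) hZn'.1
      · exact absurd (h1.trans (hmono _)) hZn'.2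
    -- Here `far m` means that each site of the term is within (n + 2 - m)ν of a cut, while `Z` is
    -- in neither slab of radius (n + 2)ν. Terms that move the half charge reach at most 2ν from a
    -- cut, which leaves `n` Lieb–Robinson steps of length `ν` before `Z` is met.
    have key := norm_commutator_evol_le_of_far s h (fun Z _ => hH.selfAdjoint Z) hJ
      (fun Z _ => hH.norm_le Z) (fun Z => s.filter fun Y => ¬ Disjoint Y Z)
      (fun Z => Finset.filter_subset _ _)
      (fun Z _ Y hY hYZ => hH.commute_of_disjoint (by simpa [hY] using hYZ))
      (N := N) (Nat.cast_nonneg N) (fun Z hZ => by exact_mod_cast hH.card_le Z hZ) A (h Z) hAZ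
      (fun m Y => ∀ i ∈ Y, circDist (i.1 - 0) + m * ν ≤ (n + 2) * ν ∨
        circDist (i.1 - ((L / 2 : ℕ) : ZMod L)) + m * ν ≤ (n + 2) * ν)
      (fun m Y _ hfar W hW k hk => by
        obtain ⟨hWs, hWY⟩ := Finset.mem_filter.1 hW
        obtain ⟨j, hjW, hjY⟩ := Finset.not_disjoint_iff.1 hWY
        have h1 := hH.extent W hWs k hk j hjW
        have e : (m + 1) * ν = m * ν + ν := by ring
        rcases hfar j hjY with h2 | h2
        · have h3 := circDist_sub_le k.1 j.1 0
          left; omega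
        · have h3 := circDist_sub_le k.1 j.1 ((L / 2 : ℕ) : ZMod L)
          right; omega)
      (fun m Y _ hfar => by
        refine hH.commute_of_disjoint (Finset.disjoint_left.2 fun i hiY hiZ => ?_)
        have e : (m + 1) * ν = m * ν + ν := by ring
        have hex : ∀ c : ZMod L, circDist (i.1 - c) + (m + 1) * ν ≤ (n + 2) * ν →
            (Z : Set (Site L M)) ⊆ slab M c ((n + 2) * ν) := fun c hfc => by
          have hle : circDist (i.1 - c) + ν ≤ (n + 2) * ν := by omega
          have hi : i ∈ slab M c (circDist (i.1 - c)) := by simp [slab]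
          exact (hH.subset_slab hZs hiZ hi).trans fun j hj => le_trans (b := circDist (i.1 - c) + ν) hj hle
        rcases hfar i hiY with h2 | h2
        · exact hZn'.1 (hex 0 h2)
        · exact hZn'.2 (hex _ h2))
      n (fun Y hY hfar => by
        have e : (n + 2) * ν = ν + ν + n * ν := by ring
        rcases hH.commute_segment_or hY with h1 | h1 | h1
        · exact h1
        · exact absurd (fun i hi => Or.inl (by
            have := h1 hi
            simp only [slab, Set.mem_ofPred_eq] at this
            omega)) hfar
        · exact absurd (fun i hi => Or.inr (by
            have := h1 hi
            simp only [slab, Set.mem_ofPred_eq] at this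
            omega)) hfar) hu huT
    refine key.trans ?_
    have := hH.norm_le Z
    gcongr
  have hderiv : ∀ u : ℝ, HasDerivAt (fun u => u * c) c u := fun u => by
    simpa using (hasDerivAt_id u).mul_const c
  have hc0 : 0 ≤ c := by positivity
  have key := norm_evol_sub_evol_le (H := ∑ Z ∈ s, h Z) (K := ∑ Z ∈ near, h Z)
    (Op.isSelfAdjoint_sum _ fun Z _ => hH.selfAdjoint Z) A hderiv ht fun u hu hut => by
      rw [hdiff, Finset.sum_mul, Finset.mul_sum, ← Finset.sum_sub_distrib]
      refine (norm_sum_le_of_le _ fun Z hZ => ?_).trans (b := ∑ Z ∈ s \ near, 2 * ‖A‖ *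
        (T * (s.card * (2 * J * J * ((2 * J * N * T) ^ n / n.factorial))))) ?_
      · rw [norm_sub_rev]
        exact hterm Z hZ u hu (hut.trans htT)
      · rw [Finset.sum_const, nsmul_eq_mul, hc]
        gcongr
        exact Finset.sdiff_subset
  refine key.trans ?_
  simp only [zero_mul, sub_zero]
  gcongr

/-- The evolution of the half charge depends only on the terms near the cuts. -/
lemma norm_evol_sub_evol_le (hH : IsFiniteRange q s h J N ν) {n : ℕ}
    (near : Finset (Finset (Site L M)))
    (hnear : ∀ Z : Finset (Site L M), Z ∈ near ↔ Z ∈ s ∧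
      ((Z : Set (Site L M)) ⊆ slab M 0 ((n + 2) * ν) ∨
      (Z : Set (Site L M)) ⊆ slab M ((L / 2 : ℕ) : ZMod L) ((n + 2) * ν)))
    {t T : ℝ} (htT : |t| ≤ T) :
    ‖evol (∑ Z ∈ s, h Z) t (q.segment 0 (L / 2)) -
      evol (∑ Z ∈ near, h Z) t (q.segment 0 (L / 2))‖ ≤
      T * (s.card * (2 * ‖q.segment 0 (L / 2)‖ *
        (T * (s.card * (2 * J * J * ((2 * J * N * T) ^ n / n.factorial)))))) := by
  rcases le_total 0 t with ht | ht
  · exact hH.norm_evol_sub_evol_le_of_nonneg near hnear ht ((le_abs_self t).trans htT)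
  -- Negative times are positive times for the Hamiltonian with opposite sign.
  · have key := hH.neg.norm_evol_sub_evol_le_of_nonneg near hnear (neg_nonneg.2 ht)
      ((neg_le_abs t).trans htT)
    simpa [Finset.sum_neg_distrib, evol_neg_left] using key

end IsFiniteRange

end

/-! ### The twist by the half charge in a translation invariant gapped state. -/

noncomputable section

open Heisenberg MeasureTheory

variable {L : ℕ} [NeZero L] {M : Type} [Fintype M] [DecidableEq M] {d : M → ℕ} {qmax : ℝ}

lemma inner_translation_conj {ψ : ManyBody L d} {lam : ℂ}
    (hlam : ‖lam‖ = 1) (hT : translation L d ψ = lam • ψ) (A : Op L d) :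
    inner ℂ ψ ((translation L d * A * star (translation L d)) ψ) = inner ℂ ψ (A ψ) := by
  have hU := translation_mem_unitary (L := L) (d := d)
  have h1 : inner ℂ (translation L d ψ)
      ((translation L d * A * star (translation L d)) (translation L d ψ)) = inner ℂ ψ (A ψ) := by
    rw [← mul_apply_eq_comp _ (translation L d), mul_assoc, (Unitary.mem_iff.1 hU).1, mul_one,
      mul_apply_eq_comp, ContinuousLinearMap.inner_map_map_of_mem_unitary hU]
  rw [← h1, hT, map_smul, inner_smul_left, inner_smul_right, ← mul_assoc, mul_comm _ lam,
    Complex.mul_conj, Complex.normSq_eq_norm_sq, hlam]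
  simp

/-- In a translation invariant state all columns carry the same charge. -/
lemma inner_total_eq (q : SiteCharge qmax L d) {ψ : ManyBody L d} {lam : ℂ}
    (hlam : ‖lam‖ = 1) (hT : translation L d ψ = lam • ψ) (k : ℕ) :
    inner ℂ ψ (q.total ψ) = L * inner ℂ ψ (q.segment k (k + 1) ψ) := by
  have h1 : ∀ k, inner ℂ ψ (q.segment k (k + 1) ψ) = inner ℂ ψ (q.segment 0 1 ψ) := by
    intro k
    induction k with
    | zero => rfl
    | succ k ih => rw [← ih, ← q.translation_conj_segment, inner_translation_conj hlam hT]
  have h2 : ∀ k, inner ℂ ψ (q.segment 0 k ψ) = k * inner ℂ ψ (q.segment 0 1 ψ) := by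
    intro k
    induction k with
    | zero => simp [SiteCharge.segment]
    | succ k ih =>
      rw [← q.segment_add_segment (Nat.zero_le k) (Nat.le_add_right k 1), add_apply,
        inner_add_right, ih, h1 k]
      push_cast
      ring
  rw [← q.segment_zero_length, h2, h1 k]

namespace IsFiniteRange

variable {q : SiteCharge qmax L d} {s : Finset (Finset (Site L M))}
  {h : Finset (Site L M) → Op L d} {J : ℝ} {N ν : ℕ}

/-- Twisting the ground state by the charge of half of the system: the filling is almost an
integer, up to the error of the time filter `μ` and the Lieb–Robinson tail. -/
theorem norm_exp_filling_sub_one_le (hH : IsFiniteRange q s h J N ν) {n : ℕ}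
    (hL : 2 * ((n + 2) * ν) + ν + 2 < L / 2)
    {ψ : ManyBody L d} {E₀ γ : ℝ} (hψ : IsGapped (∑ Z ∈ s, h Z) ψ E₀ γ) {lam : ℂ}
    (hTψ : translation L d ψ = lam • ψ) (μ : Measure ℝ) [IsProbabilityMeasure μ] {T ε : ℝ}
    (hμT : ∀ᵐ t ∂μ, |t| ≤ T) (hε : 0 ≤ ε) (hμε : ∀ ω, γ ≤ ω → ‖charFun μ ω‖ ≤ ε)
    {B : ℝ} (hB : ∀ a b, b - a ≤ L → ‖q.segment a b‖ ≤ B) {η β : ℝ}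
    (hη : ε * B + T * (s.card * (2 * B *
      (T * (s.card * (2 * J * J * ((2 * J * N * T) ^ n / n.factorial)))))) ≤ η)
    (hβ : s.card * J + 3 * B ≤ β) :
    ‖Complex.exp (2 * Real.pi * (-(inner ℂ ψ (q.total ψ) / L).re : ℝ) * Complex.I) - 1‖ ≤
      4 * Real.pi * η + 2 * Real.pi * √(8 * η * β ^ 2 / γ) + 2 * √(8 * Real.pi * η * β / γ) := by
  classical
  set U := translation L d with hUdef
  have hU : U ∈ unitary (Op L d) := translation_mem_unitary
  set r := (n + 2) * ν with hr
  set m := L / 2 with hm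
  have hJ := hH.nonneg
  have hB0 : 0 ≤ B := (norm_nonneg _).trans (hB 0 0 (by simp))
  have hT0 : 0 ≤ T := by
    obtain ⟨t, ht⟩ := hμT.exists
    exact (abs_nonneg t).trans ht
  set H := ∑ Z ∈ s, h Z with hHdef
  -- the Hamiltonians near the cuts
  set s₁ := s.filter fun Z : Finset (Site L M) => (Z : Set (Site L M)) ⊆ slab M 0 r
  -- The first condition matters only for the empty set, which lies in both slabs and must not be
  -- counted twice.
  set s₂ := s.filter fun Z : Finset (Site L M) => ¬ (Z : Set (Site L M)) ⊆ slab M 0 r ∧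
    (Z : Set (Site L M)) ⊆ slab M ((m : ℕ) : ZMod L) r
  set H₁ := ∑ Z ∈ s₁, h Z
  set H₂ := ∑ Z ∈ s₂, h Z
  have hH₁s : IsSelfAdjoint H₁ := Op.isSelfAdjoint_sum _ fun Z _ => hH.selfAdjoint Z
  have hH₂s : IsSelfAdjoint H₂ := Op.isSelfAdjoint_sum _ fun Z _ => hH.selfAdjoint Z
  have hH₁ : H₁ ∈ localAlgebra d (slab M (0 : ZMod L) r) := sum_mem fun Z hZ =>
    localAlgebra_mono (Finset.mem_filter.1 hZ).2 (hH.mem Z)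
  have hH₂ : H₂ ∈ localAlgebra d (slab M ((m : ℕ) : ZMod L) r) := sum_mem fun Z hZ =>
    localAlgebra_mono (Finset.mem_filter.1 hZ).2.2 (hH.mem Z)
  -- the charges
  set C₁ := q.segment 0 (r + 1)
  set S := q.segment (r + 1) (m - r)
  set C₂ := q.segment (m - r) m
  -- One column shorter than `S` on the left: the translate of `D₁` reaches column r + 1, which the
  -- bulk charge has to give up in order to commute with it.
  set S' := q.segment (r + 2) (m - r)
  have hC : q.segment 0 m = C₁ + C₂ + S := by
    rw [add_right_comm, q.segment_add_segment (by omega) (by omega),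
      q.segment_add_segment (by omega) (by omega)]
  have hdist : ∀ k, k ≤ m → circDist ((k : ZMod L) - 0) = k ∧
      circDist ((k : ZMod L) - (m : ZMod L)) = m - k := fun k hk =>
    ⟨by rw [sub_zero, circDist_natCast hk], circDist_natCast_sub hk le_rfl⟩
  have hC₁ : C₁ ∈ localAlgebra d (slab M (0 : ZMod L) r) :=
    q.segment_mem_localAlgebra fun k _ hk m' => by
      have := (hdist k (by omega)).1
      simp only [slab, Set.mem_ofPred_eq]; omega
  have hC₂ : C₂ ∈ localAlgebra d (slab M ((m : ℕ) : ZMod L) r) :=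
    q.segment_mem_localAlgebra fun k hk hk' m' => by
      have := (hdist k (by omega)).2
      simp only [slab, Set.mem_ofPred_eq]; omega
  have hseg₁ : ∀ r' a b, r' < a → b ≤ m →
      q.segment a b ∈ localAlgebra d (slab M (0 : ZMod L) r')ᶜ := fun r' a b ha hb =>
    q.segment_mem_localAlgebra fun k hk hk' m' => by
      have := (hdist k (by omega)).1
      simp only [slab, Set.mem_compl_iff, Set.mem_ofPred_eq]; omega
  have hseg₂ : ∀ a b, b ≤ m - r →
      q.segment a b ∈ localAlgebra d (slab M ((m : ℕ) : ZMod L) r)ᶜ := fun a b hb =>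
    q.segment_mem_localAlgebra fun k hk hk' m' => by
      have := (hdist k (by omega)).2
      simp only [slab, Set.mem_compl_iff, Set.mem_ofPred_eq]; omega
  have hcuts : ∀ r₁ r₂, r₁ + r₂ < m →
      Disjoint (slab M (0 : ZMod L) r₁) (slab M ((m : ℕ) : ZMod L) r₂) :=
    fun r₁ r₂ hrr => disjoint_slab_cuts hrr
  have hH₁₂ : Commute H₁ H₂ := commute_of_mem_localAlgebra (hcuts r r (by omega)) hH₁ hH₂
  have hH₂C₁ : Commute H₂ C₁ :=
    (commute_of_mem_localAlgebra (hcuts r r (by omega)) hC₁ hH₂).symm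
  have hH₁C₂ : Commute H₁ C₂ := commute_of_mem_localAlgebra (hcuts r r (by omega)) hH₁ hC₂
  have hH₁S : Commute H₁ S := commute_of_mem_localAlgebra disjoint_compl_right hH₁
    (hseg₁ r _ _ (by omega) (by omega))
  have hH₂S : Commute H₂ S := commute_of_mem_localAlgebra disjoint_compl_right hH₂
    (hseg₂ _ _ (by omega))
  -- the localized generators
  set D₁ := timeAverage μ H₁ C₁
  set D₂ := timeAverage μ H₂ C₂
  have hD₁s : IsSelfAdjoint D₁ := isSelfAdjoint_timeAverage hH₁s (q.isSelfAdjoint_segment _ _)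
  have hD₂s : IsSelfAdjoint D₂ := isSelfAdjoint_timeAverage hH₂s (q.isSelfAdjoint_segment _ _)
  have hD₁ : D₁ ∈ localAlgebra d (slab M (0 : ZMod L) r) :=
    timeAverage_mem_localAlgebra hH₁s hH₁ hC₁ μ
  have hD₂ : D₂ ∈ localAlgebra d (slab M ((m : ℕ) : ZMod L) r) :=
    timeAverage_mem_localAlgebra hH₂s hH₂ hC₂ μ
  have hUD₁ : U * D₁ * star U ∈ localAlgebra d (slab M (0 : ZMod L) (r + 1)) :=
    translation_conj_mem_localAlgebra (siteShift_mem_slab (by omega)) hD₁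
  have hUD₂ : U * D₂ * star U ∈ localAlgebra d (slab M ((m : ℕ) : ZMod L) (r + 1)) :=
    translation_conj_mem_localAlgebra (siteShift_mem_slab (by omega)) hD₂
  -- The bulk charge is fixed by both cut Hamiltonians, and each boundary charge evolves under the
  -- Hamiltonian of its own cut only.
  have hG : timeAverage μ (H₁ + H₂) (q.segment 0 m) = D₁ + D₂ + S := by
    rw [hC, timeAverage_add (hH₁s.add hH₂s), timeAverage_add (hH₁s.add hH₂s),
      timeAverage_of_commute (hH₁S.add_left hH₂S), timeAverage_add_of_commute hH₁₂ hH₂C₁,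
      add_comm H₁ H₂, timeAverage_add_of_commute hH₁₂.symm hH₁C₂]
  -- The bulk charge loses column r + 1 and gains column m - r when translated; each of these
  -- columns is assigned to the operator at the nearer cut.
  set a₁ := U * D₁ * star U - D₁ - q.segment (r + 1) (r + 2)
  set a₂ := U * D₂ * star U - D₂ + q.segment (m - r) (m - r + 1)
  have hconjs : ∀ {A : Op L d}, IsSelfAdjoint A → IsSelfAdjoint (U * A * star U) := fun hA =>
    hA.conjugate U
  have ha₁s : IsSelfAdjoint a₁ :=
    sub_mem (S := AddSubgroup (Op L d)) (H := _root_.selfAdjoint (Op L d))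
      (sub_mem (hconjs hD₁s) hD₁s) (q.isSelfAdjoint_segment _ _)
  have ha₂s : IsSelfAdjoint a₂ :=
    add_mem (S := AddSubgroup (Op L d)) (s := _root_.selfAdjoint (Op L d))
      (sub_mem (hconjs hD₂s) hD₂s) (q.isSelfAdjoint_segment _ _)
  have ha₁ : a₁ ∈ localAlgebra d (slab M (0 : ZMod L) (r + 1)) := by
    refine sub_mem (sub_mem hUD₁ (localAlgebra_mono (slab_mono (by omega)) hD₁))
      (q.segment_mem_localAlgebra fun k _ hk m' => ?_)
    have := (hdist k (by omega)).1
    simp only [slab, Set.mem_ofPred_eq]; omega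
  have ha₂ : a₂ ∈ localAlgebra d (slab M ((m : ℕ) : ZMod L) (r + 1)) := by
    refine add_mem (sub_mem hUD₂ (localAlgebra_mono (slab_mono (by omega)) hD₂))
      (q.segment_mem_localAlgebra fun k hk hk' m' => ?_)
    have := (hdist k (by omega)).2
    simp only [slab, Set.mem_ofPred_eq]; omega
  have hSsplit : S = q.segment (r + 1) (r + 2) + S' :=
    (q.segment_add_segment (by omega) (by omega)).symm
  have hshift : U * (D₁ + D₂ + S) * star U = D₁ + D₂ + S + a₁ + a₂ := by
    have h1 : U * S * star U = S' + q.segment (m - r) (m - r + 1) := by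
      rw [q.translation_conj_segment, q.segment_add_segment (by omega) (by omega)]
    rw [mul_add, mul_add, add_mul, add_mul, h1, hSsplit]
    simp only [a₁, a₂]
    abel
  have hadd : D₁ + D₂ + S + a₁ = U * D₁ * star U + D₂ + S' := by
    rw [hSsplit]
    simp only [a₁]
    abel
  -- the approximate eigenvalue equation
  have hHs := hψ.selfAdjoint
  have hnear : ∑ Z ∈ s₁ ∪ s₂, h Z = H₁ + H₂ := by
    refine Finset.sum_union (Finset.disjoint_left.2 fun Z hZ₁ hZ₂ => ?_)
    exact (Finset.mem_filter.1 hZ₂).2.1 (Finset.mem_filter.1 hZ₁).2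
  have hloc : ‖timeAverage μ H (q.segment 0 m) - (D₁ + D₂ + S)‖ ≤
      T * (s.card * (2 * B *
        (T * (s.card * (2 * J * J * ((2 * J * N * T) ^ n / n.factorial)))))) := by
    rw [← hG]
    refine norm_timeAverage_sub_le hHs (hH₁s.add hH₂s) _ ?_
    filter_upwards [hμT] with t ht
    have key := hH.norm_evol_sub_evol_le (n := n) (s₁ ∪ s₂) (fun Z => by
      simp only [s₁, s₂, Finset.mem_union, Finset.mem_filter]
      tauto) ht
    rw [hnear] at key
    refine key.trans ?_
    have := hB 0 m (by omega)
    gcongr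
  set x : ℝ := (inner ℂ ψ (q.segment 0 m ψ)).re
  have hxc : inner ℂ ψ (q.segment 0 m ψ) = (x : ℂ) := by
    refine (Complex.conj_eq_iff_re.1 ?_).symm
    rw [inner_conj_symm]
    exact (q.isSelfAdjoint_segment 0 m).isSymmetric ψ ψ
  have hGψ : ‖(D₁ + D₂ + S) ψ - (x : ℂ) • ψ‖ ≤ η := by
    have h1 := hψ.norm_timeAverage_apply_sub_le μ hε hμε (q.segment 0 m)
    rw [hxc] at h1
    have h2 := ContinuousLinearMap.le_opNorm (timeAverage μ H (q.segment 0 m) - (D₁ + D₂ + S)) ψ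
    rw [hψ.norm_eq, mul_one] at h2
    have h3 : (D₁ + D₂ + S) ψ - (x : ℂ) • ψ =
        (timeAverage μ H (q.segment 0 m) ψ - (x : ℂ) • ψ) -
          (timeAverage μ H (q.segment 0 m) - (D₁ + D₂ + S)) ψ := by
      rw [sub_apply]; abel
    rw [h3]
    refine (norm_sub_le _ _).trans (le_trans ?_ hη)
    have h4 : ε * ‖q.segment 0 m‖ ≤ ε * B :=
      mul_le_mul_of_nonneg_left (hB 0 m (by omega)) hε
    linarith [h2.trans hloc]
  have hHβ : ‖H‖ ≤ β := hH.norm_sum_le.trans (by linarith)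
  have haβ : ‖a₁‖ ≤ β := by
    have h1 : ‖D₁‖ ≤ B := (norm_timeAverage_le hH₁s _).trans (hB _ _ (by omega))
    have h2 : ‖U * D₁ * star U‖ ≤ B := by
      rwa [CStarRing.norm_mul_mem_unitary _ (Unitary.star_mem hU),
        CStarRing.norm_mem_unitary_mul _ hU]
    have h3 := hB (r + 1) (r + 2) (by omega)
    have h4 : (0 : ℝ) ≤ s.card * J := mul_nonneg (Nat.cast_nonneg _) hJ
    calc ‖a₁‖ ≤ ‖U * D₁ * star U‖ + ‖D₁‖ + ‖q.segment (r + 1) (r + 2)‖ :=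
          (norm_sub_le _ _).trans (add_le_add (norm_sub_le _ _) le_rfl)
      _ ≤ β := by linarith
  have hlam : ‖lam‖ = 1 := by
    have := ContinuousLinearMap.norm_map_of_mem_unitary hU ψ
    rwa [hTψ, norm_smul, hψ.norm_eq, mul_one] at this
  -- `D₁` and its translate have the same expectation in a translation invariant state, so only the
  -- subtracted column charge survives.
  have hfill : (inner ℂ ψ (a₁ ψ)).re = -(inner ℂ ψ (q.total ψ) / L).re := by
    have hL0 : (L : ℂ) ≠ 0 := by exact_mod_cast NeZero.ne L
    simp only [a₁, sub_apply, inner_sub_right]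
    rw [inner_translation_conj hlam hTψ, inner_total_eq q hlam hTψ (r + 1),
      mul_div_cancel_left₀ _ hL0]
    simp
  have hVmem := propagator_mem_localAlgebra hD₁ (2 * Real.pi)
  have key := hψ.norm_exp_sub_one_le hU hTψ hD₁s hD₂s (q.isSelfAdjoint_segment _ _) ha₁s ha₂s
    (q.propagator_segment _ _) (S' := S') (q.propagator_segment _ _)
    (commute_of_mem_localAlgebra (hcuts r r (by omega)) hD₁ hD₂)
    (commute_of_mem_localAlgebra disjoint_compl_right hD₁ (hseg₁ r _ _ (by omega) (by omega)))
    (commute_of_mem_localAlgebra disjoint_compl_right hD₂ (hseg₂ _ _ (by omega)))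
    (commute_of_mem_localAlgebra (hcuts (r + 1) r (by omega)) hUD₁ hD₂)
    (commute_of_mem_localAlgebra disjoint_compl_right hUD₁
      (hseg₁ (r + 1) _ _ (by omega) (by omega)))
    (commute_of_mem_localAlgebra disjoint_compl_right hD₂ (hseg₂ _ _ (by omega)))
    hshift hadd
    -- The tightest separation in the argument, from which the hypothesis `hL` is read off: the
    -- commutator with `H` widens the slab of `a₁` by `ν`.
    (commute_of_mem_localAlgebra (hcuts (r + 1 + ν) (r + 1) (by omega))
      (hH.commutator_mem_localAlgebra ha₁) ha₂)
    (commute_of_mem_localAlgebra (hcuts (r + ν) r (by omega))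
      (hH.commutator_mem_localAlgebra hVmem) (propagator_mem_localAlgebra hD₂ _))
    hGψ hHβ haβ
  rwa [hfill] at key

end IsFiniteRange

end

noncomputable section

open Heisenberg MeasureTheory

/-! ### Constants of the lattice geometry -/

namespace LatticeGeometry

variable (g : LatticeGeometry) (R : ℝ)

/-- A bound for the number of sites in a ball of radius `max R 0`. -/
def ballCard : ℕ := ⌈g.growth * (1 + max R 0) ^ g.dim⌉₊

/-- A bound for the number of columns over which a set of diameter `R` extends. -/
def columnRange : ℕ := ⌈|g.ratio| * max R 0⌉₊ + 1

/-- The sum of the absolute values of the coefficients of the polynomial size bound. -/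
def sizeConst : ℝ := ∑ i ∈ Finset.range (g.sizeBound.natDegree + 1), |g.sizeBound.coeff i|

lemma sizeConst_nonneg : 0 ≤ g.sizeConst := Finset.sum_nonneg fun _ _ => abs_nonneg _

lemma eval_sizeBound_le {x : ℝ} (hx : 1 ≤ x) :
    g.sizeBound.eval x ≤ g.sizeConst * x ^ g.sizeBound.natDegree := by
  rw [Polynomial.eval_eq_sum_range, sizeConst, Finset.sum_mul]
  refine Finset.sum_le_sum fun i hi => ?_
  have hx0 : 0 ≤ x := by linarith
  calc _ ≤ |g.sizeBound.coeff i| * x ^ i := by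
        gcongr; exact le_abs_self _
    _ ≤ _ := by
        gcongr
        exact Nat.lt_succ_iff.1 (Finset.mem_range.1 hi)

end LatticeGeometry

variable {L : ℕ} [NeZero L] {M : Type} [Fintype M] [DecidableEq M] {d : M → ℕ} {qmax : ℝ}

/-- A charge conserving Hamiltonian of finite range is a sum of charge conserving terms with
uniformly bounded overlaps. -/
lemma LocalHamiltonian.exists_isFiniteRange {R J : ℝ} {g : LatticeGeometry}
    {ms : MetricSpace (Site L M)} (hg : IsPeriodicLattice g L M ms)
    (H : LocalHamiltonian R J ms d) (q : SiteCharge qmax L d) (hqH : Commute q.total H.op) :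
    ∃ (s : Finset (Finset (Site L M))) (h : Finset (Site L M) → Op L d),
      IsFiniteRange q s h |J| (g.ballCard R * 2 ^ g.ballCard R) (g.columnRange R) ∧
      ∑ Z ∈ s, h Z = H.op ∧ s.card ≤ Fintype.card (Site L M) * 2 ^ g.ballCard R + 1 := by
  classical
  obtain ⟨h, h1, h2, h3, h4, h5, h6⟩ := H.exists_conserving_terms q hqH
  set R' := max R 0
  have hR' : 0 ≤ R' := le_max_right _ _
  set s : Finset (Finset (Site L M)) :=
    Finset.univ.filter fun Z => ∀ i ∈ Z, ∀ j ∈ Z, ms.dist i j ≤ R'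
  set ball : Site L M → Finset (Site L M) := fun i => Finset.univ.filter fun j => ms.dist i j ≤ R'
  have hball : ∀ i, (ball i).card ≤ g.ballCard R := fun i => by
    have hb := hg.card_ball_le i R' hR'
    rw [Set.ncard_eq_toFinset_card'] at hb
    have he : {j : Site L M | ms.dist i j ≤ R'}.toFinset = ball i := by ext; simp [ball]
    rw [he] at hb
    exact_mod_cast hb.trans (Nat.le_ceil _)
  have hsub : ∀ Z ∈ s, ∀ i ∈ Z, Z ⊆ ball i := fun Z hZ i hi j hj => by
    simp only [s, Finset.mem_filter, Finset.mem_univ, true_and] at hZ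
    simpa [ball] using hZ i hi j hj
  refine ⟨s, h, ⟨h1, h2, abs_nonneg J, fun Z => (h3 Z).trans (le_abs_self J), h5, ?_, ?_⟩, ?_, ?_⟩
  · intro Z hZ i hi j hj
    simp only [s, Finset.mem_filter, Finset.mem_univ, true_and] at hZ
    have hd := hZ i hi j hj
    have hd0 : 0 ≤ ms.dist i j := by
      let _ := ms
      exact dist_nonneg
    have hc : (circDist (i.1 - j.1) : ℝ) ≤ |g.ratio| * R' :=
      (hg.circ_le i j).trans (by gcongr; exact le_abs_self _)
    have : circDist (i.1 - j.1) ≤ ⌈|g.ratio| * R'⌉₊ := by exact_mod_cast hc.trans (Nat.le_ceil _)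
    exact this.trans (Nat.le_succ _)
  · intro Z hZ
    have hZcard : Z.card ≤ g.ballCard R := by
      rcases Z.eq_empty_or_nonempty with rfl | ⟨i, hi⟩
      · simp
      · exact (Finset.card_le_card (hsub Z hZ i hi)).trans (hball i)
    have hcov : (s.filter fun Y => ¬ Disjoint Y Z) ⊆ Z.biUnion fun i => (ball i).powerset := by
      intro Y hY
      obtain ⟨hYs, hYZ⟩ := Finset.mem_filter.1 hY
      obtain ⟨i, hiY, hiZ⟩ := Finset.not_disjoint_iff.1 hYZ
      exact Finset.mem_biUnion.2 ⟨i, hiZ, Finset.mem_powerset.2 (hsub Y hYs i hiY)⟩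
    refine (Finset.card_le_card hcov).trans ((Finset.card_biUnion_le_card_mul _ _ _
      fun i _ => ?_).trans (Nat.mul_le_mul_right _ hZcard))
    rw [Finset.card_powerset]
    exact Nat.pow_le_pow_right (by norm_num) (hball i)
  · rw [← h6]
    refine Finset.sum_subset (Finset.subset_univ s) fun Z _ hZ => h4 Z ?_
    simp only [s, Finset.mem_filter, Finset.mem_univ, true_and] at hZ
    push Not at hZ
    obtain ⟨i, hi, j, hj, hij⟩ := hZ
    exact ⟨i, hi, j, hj, (le_max_left _ _).trans_lt hij⟩
  -- Every nonempty set in `s` lies in the ball around any of its sites; the empty set accounts for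
  -- the extra 1.
  · have hcov : s ⊆ insert ∅ (Finset.univ.biUnion fun i => (ball i).powerset) := by
      intro Z hZ
      rcases Z.eq_empty_or_nonempty with rfl | ⟨i, hi⟩
      · exact Finset.mem_insert_self _ _
      · exact Finset.mem_insert_of_mem
          (Finset.mem_biUnion.2 ⟨i, Finset.mem_univ _, Finset.mem_powerset.2 (hsub Z hZ i hi)⟩)
    refine (Finset.card_le_card hcov).trans ((Finset.card_insert_le _ _).trans
      (Nat.succ_le_succ ?_))
    refine Finset.card_biUnion_le_card_mul _ _ _ fun i _ => ?_
    rw [Finset.card_powerset]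
    exact Nat.pow_le_pow_right (by norm_num) (hball i)

/-! ### Nondegenerate ground states -/

namespace IsGroundState

variable {H : Op L d} {E₀ : ℝ} {ψ : ManyBody L d}

lemma ne_zero (h : IsGroundState H E₀ ψ) : ψ ≠ 0 := by
  rintro rfl
  simpa using h.norm_eq

lemma inner_self (h : IsGroundState H E₀ ψ) : inner ℂ ψ ψ = (1 : ℂ) := by
  rw [inner_self_eq_norm_sq_to_K, h.norm_eq]; simp

lemma eq_inner_smul (h : IsGroundState H E₀ ψ) (hdeg : ¬ IsDegenerate H E₀) {φ : ManyBody L d}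
    (hφ : H φ = (E₀ : ℂ) • φ) : φ = inner ℂ ψ φ • ψ := by
  set V := Module.End.eigenspace (H : ManyBody L d →ₗ[ℂ] ManyBody L d) (E₀ : ℂ)
  have hψV : ψ ∈ V := Module.End.mem_eigenspace_iff.2 h.eigen
  have hφV : φ ∈ V := Module.End.mem_eigenspace_iff.2 hφ
  have hne : (⟨ψ, hψV⟩ : V) ≠ 0 := fun h0 => h.ne_zero (congrArg Subtype.val h0)
  have hle : Module.finrank ℂ V ≤ 1 := Nat.lt_succ_iff.1 (not_le.1 hdeg)
  have hpos : 0 < Module.finrank ℂ V := Module.finrank_pos_iff_exists_ne_zero.2 ⟨_, hne⟩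
  obtain ⟨c, hc⟩ := (finrank_eq_one_iff_of_nonzero' _ hne).1 (le_antisymm hle hpos) ⟨φ, hφV⟩
  have hc' : φ = c • ψ := (congrArg Subtype.val hc).symm
  rw [hc', inner_smul_right, h.inner_self, mul_one]

/-- Operators commuting with `H` act on a nondegenerate ground state as scalars. -/
lemma apply_eq_of_commute (h : IsGroundState H E₀ ψ) (hdeg : ¬ IsDegenerate H E₀) {A : Op L d}
    (hA : Commute A H) : A ψ = inner ℂ ψ (A ψ) • ψ := by
  refine h.eq_inner_smul hdeg ?_
  rw [← mul_apply_eq_comp, ← hA.eq, mul_apply_eq_comp, h.eigen, map_smul]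

lemma isGapped (h : IsGroundState H E₀ ψ) (hH : IsSelfAdjoint H) (hdeg : ¬ IsDegenerate H E₀)
    {E₁ : ℝ} (hE₁ : IsFirstExcited H E₀ E₁) : IsGapped H ψ E₀ (E₁ - E₀) where
  selfAdjoint := hH
  eigen := h.eigen
  norm_eq := h.norm_eq
  pos := sub_pos.2 hE₁.1.2
  gap e φ hφ := by
    by_cases h0 : φ = 0
    · left; simp [h0]
    have he : e ∈ energies H :=
      Module.End.hasEigenvalue_of_hasEigenvector ⟨Module.End.mem_eigenspace_iff.2 hφ, h0⟩
    rcases (h.isLeast.2 he).eq_or_lt with h1 | h1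
    · left
      exact h.eq_inner_smul hdeg (by rw [h1]; exact hφ)
    · right
      rw [add_sub_cancel]
      exact hE₁.2 ⟨he, h1⟩

/-- The spectrum is finite, so a least excited energy can fail to exist only if `H` is a scalar.
That case is excluded later, since nondegeneracy would then make `ψ` an eigenvector of every
operator. -/
lemma exists_firstExcited_or (h : IsGroundState H E₀ ψ) (hH : IsSelfAdjoint H) :
    (∃ E₁, IsFirstExcited H E₀ E₁) ∨ ∀ φ, H φ = (E₀ : ℂ) • φ := by
  set X := {E : ℝ | E ∈ energies H ∧ E₀ < E}
  rcases X.eq_empty_or_nonempty with hX | hX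
  · right
    have hsym := hH.isSymmetric
    have hb : ∀ i, H (hsym.eigenvectorBasis rfl i) =
        (E₀ : ℂ) • hsym.eigenvectorBasis rfl i := fun i => by
      have he : hsym.eigenvalues rfl i ∈ energies H := hsym.hasEigenvalue_eigenvalues rfl i
      have h1 : hsym.eigenvalues rfl i = E₀ := by
        refine le_antisymm (not_lt.1 fun hlt => ?_) (h.isLeast.2 he)
        have : hsym.eigenvalues rfl i ∈ X := ⟨he, hlt⟩
        simp [hX] at this
      have h2 : H (hsym.eigenvectorBasis rfl i) =
          ((hsym.eigenvalues rfl i : ℝ) : ℂ) • hsym.eigenvectorBasis rfl i :=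
        hsym.apply_eigenvectorBasis rfl i
      rw [h2, h1]
    intro φ
    have := (hsym.eigenvectorBasis rfl).toBasis.ext
      (f₁ := (H : ManyBody L d →ₗ[ℂ] ManyBody L d)) (f₂ := (E₀ : ℂ) • LinearMap.id)
      fun i => by
        rw [OrthonormalBasis.coe_toBasis]
        exact hb i
    exact LinearMap.congr_fun this φ
  · left
    have hfin : X.Finite := by
      refine Set.Finite.subset (Set.Finite.preimage (f := ((↑) : ℝ → ℂ))
        Complex.ofReal_injective.injOn
        (Module.End.finite_hasEigenvalue (H : ManyBody L d →ₗ[ℂ] ManyBody L d))) ?_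
      exact fun E hE => hE.1
    obtain ⟨E₁, hE₁, hmin⟩ := Set.exists_min_image X id hfin hX
    exact ⟨E₁, hE₁, fun E hE => hmin E hE⟩

end IsGroundState

lemma abs_le_norm_of_mem_energies {H : Op L d} {e : ℝ} (he : e ∈ energies H) : |e| ≤ ‖H‖ := by
  obtain ⟨φ, hφ⟩ := Module.End.HasEigenvalue.exists_hasEigenvector he
  have h1 : H φ = (e : ℂ) • φ := hφ.apply_eq_smul
  have h2 := H.le_opNorm φ
  rw [h1, norm_smul, Complex.norm_real, Real.norm_eq_abs] at h2
  exact le_of_mul_le_mul_right h2 (norm_pos_iff.2 hφ.2)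

/-- If the ground state is an eigenvector of the charge of a column, then the filling is an
integer. -/
lemma exists_int_filling (q : SiteCharge qmax L d) {ψ : ManyBody L d} (hψ : ‖ψ‖ = 1) {lam : ℂ}
    (hlam : ‖lam‖ = 1) (hT : translation L d ψ = lam • ψ)
    (h : q.segment 0 1 ψ = inner ℂ ψ (q.segment 0 1 ψ) • ψ) :
    ∃ n : ℤ, inner ℂ ψ (q.total ψ) / (L : ℂ) = n := by
  have hψ0 : ψ ≠ 0 := norm_ne_zero_iff.1 (by rw [hψ]; norm_num)
  set e := (inner ℂ ψ (q.segment 0 1 ψ)).re with he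
  have hec : inner ℂ ψ (q.segment 0 1 ψ) = (e : ℂ) := by
    refine (Complex.conj_eq_iff_re.1 ?_).symm
    rw [inner_conj_symm]
    exact (q.isSelfAdjoint_segment 0 1).isSymmetric ψ ψ
  rw [hec] at h
  obtain ⟨n, hn⟩ := exists_int_of_propagator_two_pi_eq_one (q.propagator_segment 0 1) hψ0 h
  refine ⟨n, ?_⟩
  have hL0 : (L : ℂ) ≠ 0 := by exact_mod_cast NeZero.ne L
  rw [inner_total_eq q hlam hT 0, zero_add, mul_div_cancel_left₀ _ hL0, hec, hn]
  simp

/-- The distance of a nontrivial `L`-th root of unity from `1`. -/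
lemma four_div_le_norm_exp_sub_one {L : ℕ} (hL : 0 < L) (n : ℤ)
    (h : ∀ k : ℤ, (n : ℝ) / L ≠ k) :
    4 / (L : ℝ) ≤ ‖Complex.exp (2 * Real.pi * (-((n : ℝ) / L) : ℝ) * Complex.I) - 1‖ := by
  have hL' : (0 : ℝ) < L := by exact_mod_cast hL
  have h1 : (2 * Real.pi * (-((n : ℝ) / L) : ℝ) * Complex.I : ℂ) =
      Complex.I * ((-(2 * (Real.pi * (n / L))) : ℝ) : ℂ) := by push_cast; ring
  rw [h1, Complex.norm_exp_I_mul_ofReal_sub_one, norm_mul, Real.norm_eq_abs, Real.norm_eq_abs,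
    neg_div, Real.sin_neg, abs_neg, mul_div_cancel_left₀ _ (two_ne_zero' ℝ), abs_two]
  set k := round ((n : ℝ) / L)
  set y := (n : ℝ) / L - k with hy
  have hy1 : |y| ≤ 1 / 2 := abs_sub_round _
  have hy2 : 1 / (L : ℝ) ≤ |y| := by
    have hyL : y = ((n - k * L : ℤ) : ℝ) / L := by
      rw [hy]; push_cast; field_simp
    have hne : n - k * L ≠ 0 := fun h0 => h k (by
      rw [div_eq_iff hL'.ne']
      have : n = k * L := by linarith
      exact_mod_cast this)
    rw [hyL, abs_div, abs_of_pos hL']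
    gcongr
    exact_mod_cast Int.one_le_abs hne
  have h2 : |Real.sin (Real.pi * (n / L))| = |Real.sin (Real.pi * y)| := by
    have : Real.pi * y = Real.pi * (n / L) - k * Real.pi := by rw [hy]; ring
    rw [this, Real.sin_sub_int_mul_pi, abs_mul, abs_zpow, abs_neg, abs_one, one_zpow, one_mul]
  -- Jordan's inequality, available because rounding puts π|y| in [0, π/2].
  have h3 : 2 * |y| ≤ |Real.sin (Real.pi * y)| := by
    have hsin : |Real.sin (Real.pi * y)| = |Real.sin (Real.pi * |y|)| := by
      rcases abs_choice y with h | h <;> rw [h]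
      rw [mul_neg, Real.sin_neg, abs_neg]
    rw [hsin]
    have := Real.mul_le_sin (x := Real.pi * |y|) (by positivity)
      (by nlinarith [Real.pi_pos])
    refine le_trans (le_of_eq ?_) (this.trans (le_abs_self _))
    have := Real.pi_pos
    field_simp
  rw [h2]
  calc 4 / (L : ℝ) = 2 * (2 * (1 / L)) := by ring
    _ ≤ _ := by linarith

end

noncomputable section

open Heisenberg MeasureTheory

/-! ### Asymptotic estimates -/

/-- With η = 3P⁶ε and β = P, the factor 1/γ costs one more power of `P`, so the worst quantity under
a root is of order P⁹ε ≤ L⁻⁴. Every summand is then of order L⁻², with constants that beat 4/L from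
L = 100 on. -/
lemma twist_error_lt {P ε γ L : ℝ} (hL : 100 ≤ L) (hP : 1 ≤ P) (hγ : 0 < γ) (hγP : 1 ≤ γ * P)
    (hε : 0 ≤ ε) (hPε : P ^ 9 * ε ≤ 1 / L ^ 4) :
    4 * Real.pi * (3 * P ^ 6 * ε) + 2 * Real.pi * √(8 * (3 * P ^ 6 * ε) * P ^ 2 / γ) +
      2 * √(8 * Real.pi * (3 * P ^ 6 * ε) * P / γ) < 4 / L := by
  have hL0 : 0 < L := by linarith
  have hpi : Real.pi ≤ 3.15 := Real.pi_lt_d2.le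
  have hpi0 := Real.pi_pos
  have hinv : 1 / γ ≤ P := by rw [div_le_iff₀ hγ]; linarith
  have h4 : 1 / L ^ 4 = (1 / L ^ 2) ^ 2 := by field_simp
  have hpow : ∀ j ≤ 9, P ^ j * ε ≤ (1 / L ^ 2) ^ 2 := fun j hj => by
    rw [← h4]
    refine le_trans ?_ hPε
    gcongr
  set y := 1 / L ^ 2 with hy
  have hy0 : 0 ≤ y := by positivity
  have hy1 : y ≤ 1 := by
    rw [hy, div_le_one (by positivity)]
    nlinarith
  have e1 : 4 * Real.pi * (3 * P ^ 6 * ε) ≤ 38 * y := by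
    have := hpow 6 (by norm_num)
    calc _ = 12 * Real.pi * (P ^ 6 * ε) := by ring
      _ ≤ 12 * 3.15 * y ^ 2 := by gcongr
      _ ≤ _ := by nlinarith
  have e2 : √(8 * (3 * P ^ 6 * ε) * P ^ 2 / γ) ≤ 5 * y := by
    refine Real.sqrt_le_iff.2 ⟨by positivity, ?_⟩
    have := hpow 9 le_rfl
    calc _ = 24 * (P ^ 8 * ε) * (1 / γ) := by ring
      _ ≤ 24 * (P ^ 8 * ε) * P := by gcongr
      _ = 24 * (P ^ 9 * ε) := by ring
      _ ≤ 24 * y ^ 2 := by gcongr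
      _ ≤ _ := by nlinarith
  have e3 : √(8 * Real.pi * (3 * P ^ 6 * ε) * P / γ) ≤ 9 * y := by
    refine Real.sqrt_le_iff.2 ⟨by positivity, ?_⟩
    have := hpow 8 (by norm_num)
    calc _ = 24 * Real.pi * (P ^ 7 * ε) * (1 / γ) := by ring
      _ ≤ 24 * Real.pi * (P ^ 7 * ε) * P := by gcongr
      _ = 24 * Real.pi * (P ^ 8 * ε) := by ring
      _ ≤ 24 * 3.15 * y ^ 2 := by gcongr
      _ ≤ _ := by nlinarith
  have e4 : 100 * y ≤ 1 / L := by
    rw [hy, mul_one_div, div_le_div_iff₀ (by positivity) hL0]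
    nlinarith
  have e5 : 2 * Real.pi * √(8 * (3 * P ^ 6 * ε) * P ^ 2 / γ) ≤ 2 * 3.15 * (5 * y) := by gcongr
  have e6 : (0 : ℝ) < 1 / L := by positivity
  have e7 : 4 / L = 4 * (1 / L) := by ring
  linarith

/-- The time n/(e²(w + 1)) keeps the argument below n e⁻², and nⁿ/n! ≤ eⁿ leaves e⁻ⁿ. This fixes the
speed `δ` for which `n` steps suffice up to time nδ. -/
lemma pow_div_factorial_le_exp_neg {w : ℝ} (hw : 0 ≤ w) (n : ℕ) :
    (w * (n * (1 / (Real.exp 2 * (w + 1))))) ^ n / n.factorial ≤ Real.exp (-n) := by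
  have he := Real.exp_pos 2
  have h1 : w * (n * (1 / (Real.exp 2 * (w + 1)))) ≤ n * Real.exp (-2) := by
    rw [Real.exp_neg]
    have h2 : w / (w + 1) ≤ 1 := (div_le_one (by linarith)).2 (by linarith)
    calc _ = n * (Real.exp 2)⁻¹ * (w / (w + 1)) := by field_simp
      _ ≤ n * (Real.exp 2)⁻¹ * 1 := by gcongr
      _ = _ := by ring
  calc _ ≤ (n * Real.exp (-2)) ^ n / n.factorial := by gcongr
    _ = (n : ℝ) ^ n / n.factorial * Real.exp (-2) ^ n := by rw [mul_pow]; ring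
    _ ≤ Real.exp n * Real.exp (-2) ^ n := by
      gcongr
      exact Real.pow_div_factorial_le_exp _ (Nat.cast_nonneg n) n
    _ = _ := by
      rw [← Real.exp_nat_mul, ← Real.exp_add]
      congr 1; ring

/-- A filter supported on `[-T, T]` suppresses the frequencies above `e m / T` by `e⁻ᵐ`. -/
lemma exists_filter_measure_exp {T γ : ℝ} (hT : 0 < T) {m : ℕ} (hm : 0 < m)
    (h : Real.exp 1 * m ≤ T * γ) :
    ∃ μ : Measure ℝ, IsProbabilityMeasure μ ∧ (∀ᵐ t ∂μ, |t| ≤ T) ∧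
      ∀ ω : ℝ, γ ≤ ω → ‖charFun μ ω‖ ≤ Real.exp (-m) := by
  have hm' : (0 : ℝ) < m := by exact_mod_cast hm
  -- The m-fold convolution of widths T/m has support in [-T, T], and each factor contributes at
  -- most e⁻¹ at frequencies above `γ`.
  obtain ⟨μ, h1, h2, h3⟩ := exists_filter_measure (a := T / m) (by positivity) m
  refine ⟨μ, h1, ?_, fun ω hω => ?_⟩
  · rwa [mul_div_cancel₀ _ hm'.ne'] at h2
  · have hγ : 0 < γ := by
      have : 0 < T * γ := lt_of_lt_of_le (by positivity) h
      exact (pos_iff_pos_of_mul_pos this).1 hT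
    have hω0 : 0 < ω := hγ.trans_le hω
    refine (h3 ω hω0.ne').trans ?_
    have h4 : Real.exp 1 ≤ T / m * |ω| := by
      rw [abs_of_pos hω0, div_mul_eq_mul_div, le_div_iff₀ hm']
      exact h.trans (by gcongr)
    calc _ ≤ (1 / Real.exp 1) ^ m := by gcongr
      _ = _ := by rw [one_div, ← Real.exp_neg, ← Real.exp_nat_mul]; congr 1; ring

lemma IsPeriodicLattice.card_le_const {g : LatticeGeometry} {L : ℕ} [NeZero L] {M : Type}
    [Fintype M] {ms : MetricSpace (Site L M)}
    (hg : IsPeriodicLattice g L M ms) :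
    (Fintype.card (Site L M) : ℝ) ≤ g.sizeConst * (L : ℝ) ^ g.sizeBound.natDegree :=
  hg.card_le.trans (g.eval_sizeBound_le (by exact_mod_cast NeZero.one_le))

section

variable {L : ℕ} [NeZero L] {M : Type} [Fintype M] [DecidableEq M] {d : M → ℕ} {qmax : ℝ}

lemma exists_translation_eigenvalue {H : Op L d} {E₀ : ℝ} {ψ : ManyBody L d}
    (h : IsGroundState H E₀ ψ) (hdeg : ¬ IsDegenerate H E₀) (hT : Commute (translation L d) H) :
    ∃ lam : ℂ, ‖lam‖ = 1 ∧ translation L d ψ = lam • ψ := by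
  have h1 := h.apply_eq_of_commute hdeg hT
  refine ⟨_, ?_, h1⟩
  have h2 := ContinuousLinearMap.norm_map_of_mem_unitary
    (translation_mem_unitary (L := L) (d := d)) ψ
  rwa [h1, norm_smul, h.norm_eq, mul_one] at h2

/-- In a nondegenerate ground state the total charge is an integer. -/
lemma exists_int_inner_total {H : Op L d} {E₀ : ℝ} {ψ : ManyBody L d}
    (h : IsGroundState H E₀ ψ) (hdeg : ¬ IsDegenerate H E₀) (q : SiteCharge qmax L d)
    (hq : Commute q.total H) : ∃ n : ℤ, inner ℂ ψ (q.total ψ) = (n : ℂ) := by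
  have h1 := h.apply_eq_of_commute hdeg hq
  have hc : inner ℂ ψ (q.total ψ) = (((inner ℂ ψ (q.total ψ)).re : ℝ) : ℂ) := by
    refine (Complex.conj_eq_iff_re.1 ?_).symm
    rw [inner_conj_symm]
    exact q.isSelfAdjoint_total.isSymmetric ψ ψ
  rw [hc] at h1
  obtain ⟨n, hn⟩ := exists_int_of_propagator_two_pi_eq_one
    (q.propagator_sum Finset.univ id) h.ne_zero h1
  exact ⟨n, by rw [hc, hn]; simp⟩

end

/-- The origin of the constant of the theorem: a time proportional to the length, times a gap of
order log x / x, accommodates a filter with a logarithmic number of factors. -/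
lemma filter_length_le {x k ν δ n m γ : ℝ} (hδ : 0 < δ) (hν : 1 ≤ ν) (hx : 0 < x)
    (hlog : 0 ≤ Real.log x) (hn : x / (32 * ν) ≤ n) (hm : m ≤ 2 * k * Real.log x)
    (hγ : (64 * Real.exp 1 * k * ν / δ + 1) * (Real.log x / x) ≤ γ) (hk : 0 < k) :
    Real.exp 1 * m ≤ n * δ * γ := by
  have h0 : 0 ≤ Real.log x / x := by positivity
  have h1 : 64 * Real.exp 1 * k * ν / δ * (Real.log x / x) ≤ γ := by linarith
  have h2 : 0 ≤ n := le_trans (by positivity) hn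
  calc Real.exp 1 * m ≤ Real.exp 1 * (2 * k * Real.log x) := by gcongr
    _ = (x / (32 * ν)) * δ * (64 * Real.exp 1 * k * ν / δ * (Real.log x / x)) := by
      field_simp
      ring
    _ ≤ n * δ * γ := by gcongr

lemma localization_error_le {ε B T c J P X : ℝ} (hε : 0 ≤ ε) (hT : 0 ≤ T) (hP : 1 ≤ P)
    (hB : 0 ≤ B) (hBP : B ≤ P) (hTP : T ≤ P) (hc : 0 ≤ c) (hcP : c ≤ P) (hJ : 2 * |J| * |J| ≤ P)
    (hX0 : 0 ≤ X) (hX : X ≤ ε) :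
    ε * B + T * (c * (2 * B * (T * (c * (2 * |J| * |J| * X))))) ≤ 3 * P ^ 6 * ε := by
  have hX' : 2 * |J| * |J| * X ≤ P * ε :=
    (mul_le_mul_of_nonneg_left hX (by positivity)).trans (mul_le_mul_of_nonneg_right hJ hε)
  calc _ ≤ ε * P + P * (P * (2 * P * (P * (P * (P * ε))))) := by gcongr
    _ = (P + 2 * P ^ 6) * ε := by ring
    _ ≤ (P ^ 6 + 2 * P ^ 6) * ε := by
      gcongr
      exact le_self_pow₀ hP (by norm_num)
    _ = _ := by ring

/-! ### Choice of the scales, and the theorem. -/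

set_option maxHeartbeats 1000000 in
/-- The gap bound for long lattices. -/
theorem exists_gap_le_of_large (R J qmax : ℝ) (g : LatticeGeometry) :
    ∃ (C : ℝ) (L₀ : ℕ), ∀ (L : ℕ) [NeZero L] (M : Type) [Fintype M] [DecidableEq M]
      (ms : MetricSpace (Site L M)) (d : M → ℕ)
      (H : LocalHamiltonian R J ms d) (q : SiteCharge qmax L d)
      (E₀ E₁ : ℝ) (ψ₀ : ManyBody L d), L₀ ≤ L →
      IsPeriodicLattice g L M ms →
      Commute (translation L d) H.op →
      Commute q.total H.op →
      IsGroundState H.op E₀ ψ₀ →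
      (∀ n : ℤ, inner ℂ ψ₀ (q.total ψ₀) / (L : ℂ) ≠ (n : ℂ)) →
      ¬ IsDegenerate H.op E₀ → IsFirstExcited H.op E₀ E₁ →
      E₁ - E₀ ≤ C * (Real.log L / L) := by
  set b := g.ballCard R
  set ν := g.columnRange R with hν
  set w : ℝ := 2 * |J| * (b * 2 ^ b : ℕ) with hw
  set δ : ℝ := 1 / (Real.exp 2 * (w + 1)) with hδ
  set p := g.sizeBound.natDegree
  set c₀ := g.sizeConst
  -- With P = L^(p + 1) and ε = L^(-k) this gives P⁹ε = L⁻⁴, exactly what `twist_error_lt` asks for.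
  set k : ℕ := 9 * (p + 1) + 4 with hk
  set C : ℝ := 64 * Real.exp 1 * k * ν / δ + 1 with hC
  have hw0 : 0 ≤ w := by positivity
  have hδ0 : 0 < δ := by positivity
  have hδ1 : δ ≤ 1 := by
    rw [hδ, div_le_one (by positivity)]
    nlinarith [Real.add_one_le_exp (2 : ℝ)]
  have hν1 : 1 ≤ ν := Nat.succ_le_succ (Nat.zero_le _)
  have hν1' : (1 : ℝ) ≤ ν := by exact_mod_cast hν1
  have hc₀ : 0 ≤ c₀ := g.sizeConst_nonneg
  -- The sum of all constants in the bounds for the number of terms, the charges and the energy.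
  -- Once L ≥ A, one extra factor of `L` absorbs each of them; the last two summands leave room
  -- between the cuts.
  set A : ℝ := (c₀ * 2 ^ b + 1) * |J| + 3 * (c₀ * |qmax|) + (c₀ * 2 ^ b + 1) + 2 * |J| * |J| +
    100 * ν + 100 with hA
  have hk0 : (0 : ℝ) < k := by
    have : 0 < k := by omega
    exact_mod_cast this
  clear_value C A k
  have hev : ∀ᶠ x : ℝ in Filter.atTop, A ≤ x ∧ k * Real.log x ≤ x / (32 * ν) := by
    refine (Filter.eventually_ge_atTop A).and ?_
    have hlo := Real.isLittleO_log_id_atTop.def (c := 1 / (32 * ν * k)) (by positivity)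
    filter_upwards [hlo, Filter.eventually_ge_atTop 1] with x hx hx1
    rw [Real.norm_of_nonneg (Real.log_nonneg hx1), id, Real.norm_of_nonneg (by linarith)] at hx
    calc _ ≤ k * (1 / (32 * ν * k) * x) := by gcongr
      _ = _ := by
        have := hk0.ne'
        field_simp
  obtain ⟨L₀, hL₀⟩ := Filter.eventually_atTop.1
    (tendsto_natCast_atTop_atTop.eventually hev : ∀ᶠ L : ℕ in Filter.atTop, _)
  refine ⟨C, L₀, ?_⟩
  intro L _ M _ _ ms d H q E₀ E₁ ψ hL hg hT hq hψ hfill hdeg hE₁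
  obtain ⟨hAL, hlogL⟩ := hL₀ L hL
  obtain ⟨s, h, hH, hsum, hscard⟩ := H.exists_isFiniteRange hg q hq
  by_contra hgap
  rw [not_le] at hgap
  set γ := E₁ - E₀
  -- elementary bounds
  have hJ0 := abs_nonneg J
  have hq0 := abs_nonneg qmax
  have hL100 : (100 : ℝ) * ν + 100 ≤ L := by
    refine le_trans ?_ hAL
    have : 0 ≤ (c₀ * 2 ^ b + 1) * |J| + 3 * (c₀ * |qmax|) + (c₀ * 2 ^ b + 1) + 2 * |J| * |J| := by
      positivity
    linarith
  have hLpos : (0 : ℝ) < L := by linarith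
  have hL100' : 100 * ν + 100 ≤ L := by exact_mod_cast hL100
  have hlog1 : 1 ≤ Real.log L := by
    rw [Real.le_log_iff_exp_le hLpos]
    linarith [Real.exp_one_lt_d9]
  set P : ℝ := (L : ℝ) ^ (p + 1) with hP
  have hL1 : (1 : ℝ) ≤ L := by linarith
  have hP1 : 1 ≤ P := one_le_pow₀ hL1
  have hLP : (L : ℝ) ≤ P := by
    calc (L : ℝ) = L ^ 1 := (pow_one _).symm
      _ ≤ P := pow_le_pow_right₀ hL1 (by omega)
  have hLp1 : (1 : ℝ) ≤ (L : ℝ) ^ p := one_le_pow₀ hL1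
  have hscale : ∀ x : ℝ, x ≤ A → x * (L : ℝ) ^ p ≤ P := fun x hx => by
    rw [hP, pow_succ, mul_comm ((L : ℝ) ^ p)]
    gcongr
    exact hx.trans hAL
  have hcard := hg.card_le_const
  have hs : (s.card : ℝ) ≤ (c₀ * 2 ^ b + 1) * (L : ℝ) ^ p := by
    have h1 : (s.card : ℝ) ≤ Fintype.card (Site L M) * 2 ^ b + 1 := by exact_mod_cast hscard
    calc _ ≤ c₀ * (L : ℝ) ^ p * 2 ^ b + 1 * 1 := by rw [one_mul]; exact h1.trans (by gcongr)
      _ ≤ c₀ * (L : ℝ) ^ p * 2 ^ b + 1 * (L : ℝ) ^ p := by gcongr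
      _ = _ := by ring
  set B : ℝ := Fintype.card (Site L M) * |qmax| with hB
  have hB0 : 0 ≤ B := by positivity
  have hB1 : B ≤ c₀ * |qmax| * (L : ℝ) ^ p := by
    calc B ≤ c₀ * (L : ℝ) ^ p * |qmax| := by rw [hB]; gcongr
      _ = _ := by ring
  have hsum1 : 0 ≤ c₀ * 2 ^ b := by positivity
  have hsum2 : 0 ≤ c₀ * |qmax| := by positivity
  have hsum3 : 0 ≤ (c₀ * 2 ^ b + 1) * |J| := by positivity
  have hsum4 : 0 ≤ 2 * |J| * |J| := by positivity
  have hBP : B ≤ P := hB1.trans (hscale _ (by rw [hA]; linarith))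
  have hsP : (s.card : ℝ) ≤ P := hs.trans (hscale _ (by rw [hA]; linarith))
  have hβP : s.card * |J| + 3 * B ≤ P := by
    calc _ ≤ (c₀ * 2 ^ b + 1) * (L : ℝ) ^ p * |J| + 3 * (c₀ * |qmax| * (L : ℝ) ^ p) := by gcongr
      _ = ((c₀ * 2 ^ b + 1) * |J| + 3 * (c₀ * |qmax|)) * (L : ℝ) ^ p := by ring
      _ ≤ P := hscale _ (by rw [hA]; linarith)
  have hJP : 2 * |J| * |J| ≤ P := le_trans (by rw [hA] at hAL; linarith) hLP
  -- the number of Lieb–Robinson steps and the time scale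
  set n : ℕ := L / (16 * ν) with hn
  have hn16 : n * (16 * ν) ≤ L := Nat.div_mul_le_self _ _
  have hn32 : (L : ℝ) / (32 * ν) ≤ n := by
    have h1 : L < (n + 1) * (16 * ν) := by
      have h2 := Nat.div_add_mod L (16 * ν)
      have h3 := Nat.mod_lt L (show 0 < 16 * ν by omega)
      rw [← hn] at h2
      calc L = 16 * ν * n + L % (16 * ν) := h2.symm
        _ < 16 * ν * n + 16 * ν := by omega
        _ = _ := by ring
    have h1' : (L : ℝ) < (n + 1) * (16 * ν) := by exact_mod_cast h1
    rw [div_le_iff₀ (by positivity)]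
    nlinarith
  have hlong : 2 * ((n + 2) * ν) + ν + 2 < L / 2 := by
    have e1 : (n + 2) * ν = n * ν + 2 * ν := by ring
    have e2 : n * (16 * ν) = 16 * (n * ν) := by ring
    omega
  have hn0 : (0 : ℝ) < n := lt_of_lt_of_le (by positivity) hn32
  set T : ℝ := n * δ with hTdef
  have hT0 : 0 < T := by positivity
  have hTP : T ≤ P := by
    have h1 : n ≤ L := Nat.div_le_self _ _
    have h1' : (n : ℝ) ≤ L := by exact_mod_cast h1
    calc T ≤ n * 1 := by rw [hTdef]; gcongr
      _ ≤ P := by linarith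
  set ε : ℝ := 1 / (L : ℝ) ^ k with hε
  have hε0 : 0 ≤ ε := by positivity
  have hexp : ∀ m : ℕ, k * Real.log L ≤ m → Real.exp (-m) ≤ ε := fun m hm => by
    have h1 : ε = Real.exp (-(k * Real.log L)) := by
      rw [Real.exp_neg, Real.exp_nat_mul, Real.exp_log hLpos, hε, one_div]
    rw [h1]
    gcongr
  have hLR : (2 * |J| * (b * 2 ^ b : ℕ) * T) ^ n / n.factorial ≤ ε :=
    (pow_div_factorial_le_exp_neg hw0 n).trans (hexp n (hlogL.trans hn32))
  -- the filter
  set m : ℕ := k * ⌈Real.log L⌉₊ with hm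
  have hmlog : k * Real.log L ≤ m := by
    rw [hm]; push_cast
    gcongr
    exact Nat.le_ceil _
  have hm0 : 0 < m := by
    have : (0 : ℝ) < m := lt_of_lt_of_le (by positivity) hmlog
    exact_mod_cast this
  have hm2 : (m : ℝ) ≤ 2 * k * Real.log L := by
    have h1 := (Nat.ceil_lt_add_one (show 0 ≤ Real.log L by linarith)).le
    rw [hm]; push_cast
    calc (k : ℝ) * ⌈Real.log L⌉₊ ≤ k * (2 * Real.log L) := by gcongr; linarith
      _ = _ := by ring
  have hfilter : Real.exp 1 * m ≤ T * γ := by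
    refine filter_length_le hδ0 hν1' hLpos (by linarith) hn32 hm2 ?_ hk0
    rw [← hC]
    exact hgap.le
  obtain ⟨μ, hμ, hμT, hμε⟩ := exists_filter_measure_exp hT0 hm0 hfilter
  -- conclusion
  obtain ⟨lam, -, hTψ⟩ := exists_translation_eigenvalue hψ hdeg hT
  have hHs : IsSelfAdjoint H.op := Op.isSelfAdjoint_sum _ fun Z _ => H.selfAdjoint Z
  have hgapped : IsGapped (∑ Z ∈ s, h Z) ψ E₀ γ := by
    rw [hsum]; exact hψ.isGapped hHs hdeg hE₁
  have hη : ε * B + T * (s.card * (2 * B * (T * (s.card * (2 * |J| * |J| *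
      ((2 * |J| * (b * 2 ^ b : ℕ) * T) ^ n / n.factorial)))))) ≤ 3 * P ^ 6 * ε := by
    exact localization_error_le hε0 hT0.le hP1 hB0 hBP hTP (Nat.cast_nonneg _) hsP hJP
      (by positivity) hLR
  have key := hH.norm_exp_filling_sub_one_le hlong hgapped hTψ μ hμT hε0
    (fun ω hω => (hμε ω hω).trans (hexp m hmlog)) (B := B)
    (fun a c hac => q.norm_segment_le hac) hη hβP
  obtain ⟨N, hN⟩ := exists_int_inner_total hψ hdeg q hq
  have hre : (inner ℂ ψ (q.total ψ) / (L : ℂ)).re = (N : ℝ) / L := by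
    rw [hN, show (N : ℂ) / (L : ℂ) = (((N : ℝ) / (L : ℝ) : ℝ) : ℂ) by push_cast; rfl,
      Complex.ofReal_re]
  rw [hre] at key
  have hlow := four_div_le_norm_exp_sub_one (NeZero.pos L) N fun j hj => hfill j (by
    rw [hN, show (N : ℂ) / (L : ℂ) = (((N : ℝ) / (L : ℝ) : ℝ) : ℂ) by push_cast; rfl, hj]
    simp)
  -- The summand 1 in `C` guarantees γ ≥ 1/L.
  have hγL : 1 ≤ γ * P := by
    have h1 : 1 / (L : ℝ) ≤ γ := by
      refine le_trans ?_ hgap.le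
      have h5 : 1 / (L : ℝ) ≤ Real.log L / L := by gcongr
      have h6 : 0 ≤ 64 * Real.exp 1 * k * ν / δ := by positivity
      have h7 : 0 ≤ Real.log L / L := by positivity
      rw [hC]
      nlinarith
    have h8 := hgapped.pos
    calc (1 : ℝ) = 1 / L * L := by field_simp
      _ ≤ γ * P := by gcongr
  have herr := twist_error_lt (L := L) (by linarith) hP1 hgapped.pos hγL hε0 (by
    rw [hP, hε, ← pow_mul, hk, mul_comm (p + 1) 9, pow_add]
    apply le_of_eq
    field_simp)
  linarith

/-- The gap bound for lattices of bounded length. -/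
lemma gap_le_of_length_le {R J qmax : ℝ} {g : LatticeGeometry} {L L₀ : ℕ} [NeZero L] {M : Type}
    [Fintype M] [DecidableEq M] {ms : MetricSpace (Site L M)} {d : M → ℕ}
    (H : LocalHamiltonian R J ms d) (q : SiteCharge qmax L d) {E₀ E₁ : ℝ} (h2L : 2 ≤ L)
    (hL : L ≤ L₀) (hg : IsPeriodicLattice g L M ms) (hq : Commute q.total H.op)
    (hE₀ : E₀ ∈ energies H.op) (hE₁ : E₁ ∈ energies H.op) :
    E₁ - E₀ ≤ 2 * ((g.sizeConst * (L₀ : ℝ) ^ g.sizeBound.natDegree * 2 ^ g.ballCard R + 1) * |J|) *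
      (L₀ / Real.log 2) * (Real.log L / L) := by
  obtain ⟨s, h, hH, hsum, hscard⟩ := H.exists_isFiniteRange hg q hq
  have hc₀ := g.sizeConst_nonneg
  have hlog2 : 0 < Real.log 2 := Real.log_pos (by norm_num)
  have hL' : (L : ℝ) ≤ L₀ := by exact_mod_cast hL
  have h2L' : (2 : ℝ) ≤ L := by exact_mod_cast h2L
  have h1 : ‖H.op‖ ≤
      (g.sizeConst * (L₀ : ℝ) ^ g.sizeBound.natDegree * 2 ^ g.ballCard R + 1) * |J| := by
    rw [← hsum]
    refine hH.norm_sum_le.trans ?_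
    gcongr
    have h3 : (s.card : ℝ) ≤ Fintype.card (Site L M) * 2 ^ g.ballCard R + 1 := by
      exact_mod_cast hscard
    refine h3.trans ?_
    gcongr
    exact hg.card_le_const.trans (by gcongr)
  -- For 2 ≤ L ≤ L₀ the ratio log L / L is at least log 2 / L₀, so a constant suffices against the
  -- trivial bound 2‖H‖.
  have h2 : 1 ≤ (L₀ / Real.log 2) * (Real.log L / L) := by
    rw [div_mul_div_comm, le_div_iff₀ (by positivity), one_mul, mul_comm]
    gcongr
  have h3 := abs_le.1 (abs_le_norm_of_mem_energies hE₀)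
  have h4 := abs_le.1 (abs_le_norm_of_mem_energies hE₁)
  set K := (g.sizeConst * (L₀ : ℝ) ^ g.sizeBound.natDegree * 2 ^ g.ballCard R + 1) * |J|
  have hK : 0 ≤ K := (norm_nonneg _).trans h1
  rw [mul_assoc]
  nlinarith [h3.1, h4.2]

theorem theorem4 (R J qmax : ℝ) (g : LatticeGeometry) :
    ∃ C : ℝ, ∀ (L : ℕ) [NeZero L] (M : Type) [Fintype M] [DecidableEq M]
      (ms : MetricSpace (Site L M)) (d : M → ℕ)
      (H : LocalHamiltonian R J ms d) (q : SiteCharge qmax L d)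
      (E₀ : ℝ) (ψ₀ : ManyBody L d),
      IsPeriodicLattice g L M ms →
      Commute (translation L d) H.op →
      Commute q.total H.op →
      IsGroundState H.op E₀ ψ₀ →
      (∀ n : ℤ, inner ℂ ψ₀ (q.total ψ₀) / (L : ℂ) ≠ (n : ℂ)) →
      IsDegenerate H.op E₀ ∨
        ∃ E₁ : ℝ, IsFirstExcited H.op E₀ E₁ ∧ E₁ - E₀ ≤ C * (Real.log L / L) := by
  obtain ⟨C, L₀, hC⟩ := exists_gap_le_of_large R J qmax g
  refine ⟨max C (2 * ((g.sizeConst * (L₀ : ℝ) ^ g.sizeBound.natDegree * 2 ^ g.ballCard R + 1) *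
    |J|) * (L₀ / Real.log 2)), ?_⟩
  intro L _ M _ _ ms d H q E₀ ψ hg hT hq hψ hfill
  by_cases hdeg : IsDegenerate H.op E₀
  · exact Or.inl hdeg
  right
  have hHs : IsSelfAdjoint H.op := Op.isSelfAdjoint_sum _ fun Z _ => H.selfAdjoint Z
  obtain ⟨lam, hlam, hTψ⟩ := exists_translation_eigenvalue hψ hdeg hT
  -- This disposes of both degenerate cases: for L = 1 the column charge is the conserved total
  -- charge, and for a scalar `H` every vector is a ground state. Either would make `ψ` an
  -- eigenvector of the column charge.
  have hcol : q.segment 0 1 ψ ≠ inner ℂ ψ (q.segment 0 1 ψ) • ψ := fun hcol => by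
    obtain ⟨n, hn⟩ := exists_int_filling q hψ.norm_eq hlam hTψ hcol
    exact hfill n hn
  have h2L : 2 ≤ L := by
    by_contra hlt
    have h1 : L = 1 := by
      have := NeZero.pos L
      omega
    subst h1
    refine hcol ?_
    rw [q.segment_zero_length]
    exact hψ.apply_eq_of_commute hdeg hq
  obtain ⟨E₁, hE₁⟩ := (hψ.exists_firstExcited_or hHs).resolve_right fun hall =>
    hcol (hψ.eq_inner_smul hdeg (hall _))
  have hlog : 0 ≤ Real.log L / L := by positivity
  refine ⟨E₁, hE₁, ?_⟩
  rcases le_total L₀ L with hL | hL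
  · exact (hC L M ms d H q E₀ E₁ ψ hL hg hT hq hψ hfill hdeg hE₁).trans
      (mul_le_mul_of_nonneg_right (le_max_left _ _) hlog)
  · exact (gap_le_of_length_le H q h2L hL hg hq hψ.isLeast.1 hE₁.1.1).trans
      (mul_le_mul_of_nonneg_right (le_max_right _ _) hlog)

end
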